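/- Let $\mathbb K$ be a field of characteristic $0$ and $\mathfrak g$ a vector space over $\mathbb K$. Put $\mathfrak C^0=\mathrm{Hom}(\mathfrak g,\mathfrak g)$ and, for $p\ge 1$, $$\mathfrak C^p=\mathrm{Hom}\big((\wedge^2\mathfrak g)^{\otimes p},\mathfrak g\big)\oplus \mathrm{Hom}\big((\wedge^2\mathfrak g)^{\otimes p}\otimes\mathfrak g,\mathfrak g\big),$$ write $P=(P_{\rm I},P_{\rm II})$ for $P\in\mathfrak C^p$, where an element $f\in\mathfrak C^0$ is regarded as the pair $f_{\rm I}=0$, $f_{\rm II}=f$, and let $\mathfrak C^\bullet=\bigoplus_{p\ge 0}\mathfrak C^p$, graded by $p$. For an endomorphism $f$ of $\mathfrak g$ and $X=x\wedge y\in\wedge^2\mathfrak g$ let $f\star X=x\wedge f(y)+f(x)\wedge y$ (extended linearly in $X$). Let $\mathbb S_{(i,j)}$ be the set of permutations $\sigma$ of $\{1,\dots,i+j\}$ with $\sigma(1)<\dots<\sigma(i)$ and $\sigma(i+1)<\dots<\sigma(i+j)$. For $P\in\mathfrak C^p$, $Q\in\mathfrak C^q$ define $P\circ Q\in\mathfrak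 C^{p+q}$ by $$(P\circ Q)_{\rm I}(X_1,\dots,X_{p+q})=\sum_{\sigma\in\mathbb S_{(p,q)},\ \sigma(p+q)=p+q}(-1)^{pq}\,\mathrm{sign}(\sigma)\,P_{\rm II}\big(X_{\sigma(1)},\dots,X_{\sigma(p)},Q_{\rm I}(X_{\sigma(p+1)},\dots,X_{\sigma(p+q)})\big)$$ $$\qquad+\sum_{k=1}^p(-1)^{(k-1)q}\sum_{\sigma\in\mathbb S_{(k-1,q)}}\mathrm{sign}(\sigma)\,P_{\rm I}\big(X_{\sigma(1)},\dots,X_{\sigma(k-1)},\,Q_{\rm II}(X_{\sigma(k)},\dots,X_{\sigma(k+q-1)},\cdot)\star X_{k+q},\,X_{k+q+1},\dots,X_{p+q}\big),$$ $$(P\circ Q)_{\rm II}(X_1,\dots,X_{p+q},x)=\sum_{\sigma\in\mathbb S_{(p,q)}}(-1)^{pq}\,\mathrm{sign}(\sigma)\,P_{\rm II}\big(X_{\sigma(1)},\dots,X_{\sigma(p)},Q_{\rm II}(X_{\sigma(p+1)},\dots,X_{\sigma(p+q)},x)\big)$$ $$\qquad+\sum_{k=1}^p(-1)^{(k-1)q}\sum_{\sigma\in\mathbb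 S_{(k-1,q)}}\mathrm{sign}(\sigma)\,P_{\rm II}\big(X_{\sigma(1)},\dots,X_{\sigma(k-1)},\,Q_{\rm II}(X_{\sigma(k)},\dots,X_{\sigma(k+q-1)},\cdot)\star X_{k+q},\,X_{k+q+1},\dots,X_{p+q},x\big)$$ (if $p=q=0$, then $(P\circ Q)_{\rm I}=0$ and $P\circ Q$ is the composition of endomorphisms). Let $[P,Q]=P\circ Q-(-1)^{pq}Q\circ P$, extended bilinearly to $\mathfrak C^\bullet$. Then: (1) $(\mathfrak C^\bullet,[\cdot,\cdot])$ is a graded Lie algebra: the bracket has degree $0$, and for $P\in\mathfrak C^p$, $Q\in\mathfrak C^q$, $R\in\mathfrak C^r$ one has $[P,Q]=-(-1)^{pq}[Q,P]$ and $[P,[Q,R]]=[[P,Q],R]+(-1)^{pq}[Q,[P,R]]$. (2) If $\Pi=(\pi,\omega)\in\mathfrak C^1$ defines a Lie-Yamaguti algebra structure on $\mathfrak g$, i.e. with $[x,y]=\pi(x\wedge y)$ and $\{x,y,z\}=\omega(x\wedge y,z)$ the identities (a) $[[x,y],z]+[[y,z],x]+[[z,x],y]+\{x,y,z\}+\{y,z,x\}+\{z,x,y\}=0$,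 (b) $\{[x,y],z,w\}+\{[y,z],x,w\}+\{[z,x],y,w\}=0$, (c) $\{x,y,[z,w]\}=[\{x,y,z\},w]+[z,\{x,y,w\}]$, (d) $\{x,y,\{z,w,t\}\}=\{\{x,y,z\},w,t\}+\{z,\{x,y,w\},t\}+\{z,w,\{x,y,t\}\}$ hold for all $x,y,z,w,t\in\mathfrak g$, then $\Pi$ is a Maurer-Cartan element of $\mathfrak C^\bullet$, i.e. $[\Pi,\Pi]=0$. (3) More precisely, for every $\Pi=(\pi,\omega)\in\mathfrak C^1$ one has $[\Pi,\Pi]=0$ if and only if (c) and (d) hold for all $x,y,z,w,t\in\mathfrak g$. -/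

import Mathlib

open scoped DirectSum TensorProduct

noncomputable section

namespace LieYamaguti

/-! ### The exterior square -/

section Wedge

variable (K : Type*) [CommRing K] {g : Type*} [AddCommGroup g] [Module K g]

/-- The decomposable element `x ∧ y` of the exterior square of `g`. -/
def wedge (x y : g) : ⋀[K]^2 g := exteriorPower.ιMulti K 2 ![x, y]

theorem wedge_add_left (x x' y : g) : wedge K (x + x') y = wedge K x y + wedge K x' y := by
  have h := (exteriorPower.ιMulti K 2 (M := g)).map_update_add ![x, y] 0 x x'
  have e : ∀ z, Function.update ![x, y] 0 z = ![z, y] := fun z => by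
    ext i; fin_cases i <;> rfl
  rwa [e, e, e] at h

theorem wedge_smul_left (c : K) (x y : g) : wedge K (c • x) y = c • wedge K x y := by
  have h := (exteriorPower.ιMulti K 2 (M := g)).map_update_smul ![x, y] 0 c x
  have e : ∀ z, Function.update ![x, y] 0 z = ![z, y] := fun z => by
    ext i; fin_cases i <;> rfl
  rwa [e, e] at h

theorem wedge_add_right (x y y' : g) : wedge K x (y + y') = wedge K x y + wedge K x y' := by
  have h := (exteriorPower.ιMulti K 2 (M := g)).map_update_add ![x, y] 1 y y'
  have e : ∀ z, Function.update ![x, y] 1 z = ![x, z] := fun z => by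
    ext i; fin_cases i <;> rfl
  rwa [e, e, e] at h

theorem wedge_smul_right (c : K) (x y : g) : wedge K x (c • y) = c • wedge K x y := by
  have h := (exteriorPower.ιMulti K 2 (M := g)).map_update_smul ![x, y] 1 c y
  have e : ∀ z, Function.update ![x, y] 1 z = ![x, z] := fun z => by
    ext i; fin_cases i <;> rfl
  rwa [e, e] at h

theorem wedge_self (x : g) : wedge K x x = 0 :=
  (exteriorPower.ιMulti K 2 (M := g)).map_eq_zero_of_eq ![x, x] (i := 0) (j := 1) rfl (by decide)

theorem wedge_swap (x y : g) : wedge K x y = -wedge K y x := by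
  have h := wedge_self K (x + y)
  rw [wedge_add_left, wedge_add_right, wedge_add_right, wedge_self, wedge_self, zero_add,
    add_zero] at h
  exact eq_neg_of_add_eq_zero_left h

variable {K}

/-- The alternating map `(x, y) ↦ x ∧ f y + f x ∧ y` attached to an endomorphism `f`. -/
def wedgeDerAlt (f : g →ₗ[K] g) : g [⋀^Fin 2]→ₗ[K] ⋀[K]^2 g where
  toFun v := wedge K (v 0) (f (v 1)) + wedge K (f (v 0)) (v 1)
  map_update_add' v i x y := by
    fin_cases i <;> simp [wedge_add_left, wedge_add_right] <;> abel
  map_update_smul' v i c x := by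
    fin_cases i <;> simp [wedge_smul_left, wedge_smul_right]
  map_eq_zero_of_eq' v i j h hij := by
    have h01 : v 0 = v 1 := by
      fin_cases i <;> fin_cases j <;> simp_all
    simp only [h01]
    rw [wedge_swap K (v 1)]
    simp

/-- The extension of an endomorphism `f` of `g` to a derivation of the exterior square,
`x ∧ y ↦ x ∧ f y + f x ∧ y`, linear in `f`. -/
def wedgeDer : (g →ₗ[K] g) →ₗ[K] (⋀[K]^2 g →ₗ[K] ⋀[K]^2 g) where
  toFun f := exteriorPower.alternatingMapLinearEquiv (wedgeDerAlt f)
  map_add' f f' := by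
    rw [← map_add]
    congr 1
    ext v
    simp [wedgeDerAlt, wedge_add_left, wedge_add_right]
    abel
  map_smul' c f := by
    rw [RingHom.id_apply, ← map_smul]
    congr 1
    ext v
    simp [wedgeDerAlt, wedge_smul_left, wedge_smul_right]

theorem wedgeDer_wedge (f : g →ₗ[K] g) (x y : g) :
    wedgeDer f (wedge K x y) = wedge K x (f y) + wedge K (f x) y := by
  simp [wedgeDer, wedge, wedgeDerAlt]

end Wedge

/-! ### Shuffles -/

/-- `σ` is a `(p, q)`-shuffle: it is increasing on the first `p` and on the last `q` indices. -/
def IsShuffle (p q : ℕ) (σ : Equiv.Perm (Fin (p + q))) : Prop :=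
  (∀ i j : Fin p, i < j → σ (Fin.castAdd q i) < σ (Fin.castAdd q j)) ∧
    ∀ i j : Fin q, i < j → σ (Fin.natAdd p i) < σ (Fin.natAdd p j)

instance (p q : ℕ) : DecidablePred (IsShuffle p q) := fun _ =>
  inferInstanceAs (Decidable (_ ∧ _))

/-- The set of `(p, q)`-shuffles. -/
def shuffles (p q : ℕ) : Finset (Equiv.Perm (Fin (p + q))) :=
  Finset.univ.filter (IsShuffle p q)

/-- The set of `(p, q)`-shuffles which fix the last index (if there is one). -/
def shufflesFixLast (p q : ℕ) : Finset (Equiv.Perm (Fin (p + q))) :=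
  (shuffles p q).filter fun σ => ∀ i : Fin (p + q), i.val + 1 = p + q → σ i = i

/-! ### The terms of the composition -/

section Terms

variable {K : Type*} [CommRing K] {g : Type*} [AddCommGroup g] [Module K g]
variable {L W W' U : Type*} [AddCommGroup L] [Module K L] [AddCommGroup W] [Module K W]
  [AddCommGroup W'] [Module K W'] [AddCommGroup U] [Module K U]

/-- A function of several vectors which is linear in each of them separately is multilinear. -/
def multilinearOfForall {n : ℕ} (F : (Fin n → L) → W)
    (h : ∀ (X : Fin n → L) (i : Fin n), ∃ l : L →ₗ[K] W, ∀ v, F (Function.update X i v) = l v) :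
    MultilinearMap K (fun _ : Fin n => L) W where
  toFun := F
  map_update_add' X i x y := by
    rename_i inst
    rw [Subsingleton.elim inst (instDecidableEqFin n)]
    obtain ⟨l, hl⟩ := h X i
    rw [hl, hl, hl, map_add]
  map_update_smul' X i c x := by
    rename_i inst
    rw [Subsingleton.elim inst (instDecidableEqFin n)]
    obtain ⟨l, hl⟩ := h X i
    rw [hl, hl, map_smul]

/-- The term `B (P (X_σ(1), …, X_σ(p))) (Q (X_σ(p+1), …, X_σ(p+q)))`, where `B` is bilinear. -/
def outerTerm {p q : ℕ} (B : W →ₗ[K] W' →ₗ[K] U)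
    (P : MultilinearMap K (fun _ : Fin p => L) W) (Q : MultilinearMap K (fun _ : Fin q => L) W')
    (σ : Equiv.Perm (Fin (p + q))) : MultilinearMap K (fun _ : Fin (p + q) => L) U :=
  multilinearOfForall
    (fun X => B (P fun i => X (σ (Fin.castAdd q i))) (Q fun j => X (σ (Fin.natAdd p j))))
    (by
      intro X m
      obtain ⟨a, rfl⟩ := σ.surjective m
      induction a using Fin.addCases with
      | left i =>
        refine ⟨(B.flip (Q fun j => X (σ (Fin.natAdd p j)))).comp
          (P.toLinearMap (fun i => X (σ (Fin.castAdd q i))) i), fun v => ?_⟩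
        have h1 : (fun i' => Function.update X (σ (Fin.castAdd q i)) v (σ (Fin.castAdd q i'))) =
            Function.update (fun i => X (σ (Fin.castAdd q i))) i v := by
          funext i'
          by_cases hi : i' = i
          · subst hi; simp
          · simp [hi]
        have h2 : (fun j => Function.update X (σ (Fin.castAdd q i)) v (σ (Fin.natAdd p j))) =
            fun j => X (σ (Fin.natAdd p j)) := by
          funext j
          rw [Function.update_of_ne]
          intro h
          have := congrArg Fin.val (σ.injective h)
          simp at this
          omega
        rw [h1, h2]
        rfl
      | right j =>
        refine ⟨(B (P fun i => X (σ (Fin.castAdd q i)))).comp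
          (Q.toLinearMap (fun j => X (σ (Fin.natAdd p j))) j), fun v => ?_⟩
        have h1 : (fun j' => Function.update X (σ (Fin.natAdd p j)) v (σ (Fin.natAdd p j'))) =
            Function.update (fun j => X (σ (Fin.natAdd p j))) j v := by
          funext i'
          by_cases hi : i' = j
          · subst hi; simp
          · simp [hi]
        have h2 : (fun i => Function.update X (σ (Fin.natAdd p j)) v (σ (Fin.castAdd q i))) =
            fun i => X (σ (Fin.castAdd q i)) := by
          funext i
          rw [Function.update_of_ne]
          intro h
          have := congrArg Fin.val (σ.injective h)
          simp at this
          omega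
        rw [h1, h2]
        rfl)

/-- For `k < p`, the inclusion of the first `k + q` indices into all `p + q` indices. -/
def firstIdx {p : ℕ} (q : ℕ) (k : Fin p) : Fin (k + q) → Fin (p + q) :=
  Fin.castLE (by omega)

/-- The index of the vector which `insertTerm` plugs into the slot `i ≠ k` of `P`: it is `σ i`
for `i < k` and `i + q` for `i > k`. (The value at `i = k` is irrelevant.) -/
def slotIdx {p : ℕ} (q : ℕ) (k : Fin p) (σ : Equiv.Perm (Fin (k + q))) (i : Fin p) :
    Fin (p + q) :=
  if h : i.val < k.val then firstIdx q k (σ (Fin.castAdd q ⟨i.val, h⟩))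
  else ⟨i.val + q, by omega⟩

/-- With indices starting at `0`, the term
`P (X_σ(0), …, X_σ(k-1), Q(X_σ(k), …, X_σ(k+q-1)) ⋆ X_(k+q), X_(k+q+1), …, X_(p+q-1))`,
where `f ⋆ (x ∧ y) = x ∧ f y + f x ∧ y`. -/
def insertTerm {p q : ℕ} (P : MultilinearMap K (fun _ : Fin p => ⋀[K]^2 g) W)
    (Q : MultilinearMap K (fun _ : Fin q => ⋀[K]^2 g) (g →ₗ[K] g))
    (k : Fin p) (σ : Equiv.Perm (Fin (k + q))) :
    MultilinearMap K (fun _ : Fin (p + q) => ⋀[K]^2 g) W :=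
  multilinearOfForall
    (fun X => P (Function.update (fun i => X (slotIdx q k σ i)) k
      (wedgeDer (Q fun j => X (firstIdx q k (σ (Fin.natAdd k j)))) (X ⟨k + q, by omega⟩))))
    (by
      intro X m
      by_cases hm : m.val < k.val + q
      · obtain ⟨a, ha⟩ := σ.surjective ⟨m.val, hm⟩
        have hma : m = firstIdx q k (σ a) := by
          rw [ha]; rfl
        have hlast : ∀ v, Function.update X m v ⟨k + q, by omega⟩ = X ⟨k + q, by omega⟩ := by
          intro v
          rw [Function.update_of_ne]
          intro h
          have := congrArg Fin.val h
          simp at this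
          omega
        have hinj : Function.Injective (firstIdx q k) := Fin.castLE_injective _
        induction a using Fin.addCases with
        | left i₀ =>
          have hip : i₀.val < p := by omega
          refine ⟨P.toLinearMap (Function.update (fun i => X (slotIdx q k σ i)) k
            (wedgeDer (Q fun j => X (firstIdx q k (σ (Fin.natAdd k j))))
              (X ⟨k + q, by omega⟩))) ⟨i₀.val, hip⟩, fun v => ?_⟩
          have hQ : (fun j => Function.update X m v (firstIdx q k (σ (Fin.natAdd k j)))) =
              fun j => X (firstIdx q k (σ (Fin.natAdd k j))) := by
            funext j
            rw [Function.update_of_ne]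
            rw [hma]
            intro h
            have := congrArg Fin.val (σ.injective (hinj h))
            simp at this
            omega
          rw [hQ, hlast]
          change P _ = P _
          congr 1
          funext i
          by_cases hik : i = k
          · subst hik
            rw [Function.update_self, Function.update_of_ne, Function.update_self]
            intro h
            have := congrArg Fin.val h
            simp at this
            omega
          · rw [Function.update_of_ne hik]
            by_cases hii : i = ⟨i₀.val, hip⟩
            · subst hii
              rw [Function.update_self]
              have : slotIdx q k σ ⟨i₀.val, hip⟩ = m := by
                rw [hma]; simp [slotIdx]
              rw [this, Function.update_self]
            · rw [Function.update_of_ne hii, Function.update_of_ne hik, Function.update_of_ne]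
              rw [hma]
              unfold slotIdx
              split_ifs with h
              · intro h'
                have h2 := congrArg Fin.val (σ.injective (hinj h'))
                simp at h2
                exact hii (Fin.ext h2)
              · intro h'
                have h2 := congrArg Fin.val h'
                rw [← hma] at h2
                simp at h2
                omega
        | right j₀ =>
          refine ⟨(P.toLinearMap (fun i => X (slotIdx q k σ i)) k).comp
            ((wedgeDer.flip (X ⟨k + q, by omega⟩)).comp
              (Q.toLinearMap (fun j => X (firstIdx q k (σ (Fin.natAdd k j)))) j₀)),
            fun v => ?_⟩
          have hQ : (fun j => Function.update X m v (firstIdx q k (σ (Fin.natAdd k j)))) =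
              Function.update (fun j => X (firstIdx q k (σ (Fin.natAdd k j)))) j₀ v := by
            funext j
            by_cases hj : j = j₀
            · subst hj; rw [hma]; simp
            · rw [Function.update_of_ne hj, Function.update_of_ne]
              rw [hma]
              intro h
              exact hj (by simpa using σ.injective (hinj h))
          rw [hQ, hlast]
          change P _ = P _
          congr 1
          funext i
          by_cases hik : i = k
          · subst hik
            rw [Function.update_self, Function.update_self]
            rfl
          · rw [Function.update_of_ne hik, Function.update_of_ne hik, Function.update_of_ne]
            unfold slotIdx
            split_ifs with h
            · rw [hma]
              intro h'
              have h2 := congrArg Fin.val (σ.injective (hinj h'))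
              simp at h2
              omega
            · intro h'
              have h2 := congrArg Fin.val h'
              simp at h2
              omega
      · have hQ : ∀ v, (fun j => Function.update X m v (firstIdx q k (σ (Fin.natAdd k j)))) =
              fun j => X (firstIdx q k (σ (Fin.natAdd k j))) := by
          intro v
          funext j
          rw [Function.update_of_ne]
          intro h
          apply hm
          rw [← h]
          exact (σ (Fin.natAdd k j)).isLt
        by_cases hmk : m.val = k.val + q
        · refine ⟨(P.toLinearMap (fun i => X (slotIdx q k σ i)) k).comp
            (wedgeDer (Q fun j => X (firstIdx q k (σ (Fin.natAdd k j))))), fun v => ?_⟩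
          have hmm : m = ⟨k + q, by omega⟩ := Fin.ext hmk
          rw [hQ, ← hmm, Function.update_self]
          change P _ = P _
          congr 1
          funext i
          by_cases hik : i = k
          · subst hik
            rw [Function.update_self, Function.update_self]
          · rw [Function.update_of_ne hik, Function.update_of_ne hik, Function.update_of_ne]
            rw [hmm]
            unfold slotIdx
            split_ifs with h
            · intro h'
              have h2 := congrArg Fin.val h'
              have h3 := (σ (Fin.castAdd q ⟨i.val, h⟩)).isLt
              simp [firstIdx] at h2
              omega
            · intro h'
              have h2 := congrArg Fin.val h'
              simp at h2
              exact hik (Fin.ext h2)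
        · have hip : m.val - q < p := by omega
          refine ⟨P.toLinearMap (Function.update (fun i => X (slotIdx q k σ i)) k
            (wedgeDer (Q fun j => X (firstIdx q k (σ (Fin.natAdd k j))))
              (X ⟨k + q, by omega⟩))) ⟨m.val - q, hip⟩, fun v => ?_⟩
          have hlast : Function.update X m v ⟨k + q, by omega⟩ = X ⟨k + q, by omega⟩ := by
            rw [Function.update_of_ne]
            intro h
            exact hmk (congrArg Fin.val h).symm
          rw [hQ, hlast]
          change P _ = P _
          congr 1
          funext i
          by_cases hik : i = k
          · subst hik
            rw [Function.update_self, Function.update_of_ne, Function.update_self]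
            intro h
            have := congrArg Fin.val h
            simp at this
            omega
          · rw [Function.update_of_ne hik]
            by_cases hii : i = ⟨m.val - q, hip⟩
            · have hs : slotIdx q k σ i = m := by
                subst hii
                unfold slotIdx
                rw [dif_neg (by simp; omega)]
                apply Fin.ext
                simp
                omega
              rw [hs, hii, Function.update_self, Function.update_self]
            · rw [Function.update_of_ne hii, Function.update_of_ne hik, Function.update_of_ne]
              unfold slotIdx
              split_ifs with h
              · intro h'
                have h2 := congrArg Fin.val h'
                have h3 := (σ (Fin.castAdd q ⟨i.val, h⟩)).isLt
                simp [firstIdx] at h2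
                omega
              · intro h'
                have h2 := congrArg Fin.val h'
                simp at h2
                exact hii (Fin.ext (by simp; omega)))

end Terms

/-! ### Cochains -/

section Cochains

variable (K : Type*) [CommRing K] (g : Type*) [AddCommGroup g] [Module K g]

/-- `Hom((∧²g)^{⊗p}, g)`, as multilinear maps in `p` variables from `∧²g`. -/
abbrev HomI (p : ℕ) : Type _ := MultilinearMap K (fun _ : Fin p => ⋀[K]^2 g) g

/-- `Hom((∧²g)^{⊗p} ⊗ g, g)`, as multilinear maps in `p` variables from `∧²g` with values in
`Hom(g, g)`. -/
abbrev HomII (p : ℕ) : Type _ := MultilinearMap K (fun _ : Fin p => ⋀[K]^2 g) (g →ₗ[K] g)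

/-- The pairs `(P_I, P_II)`, where `P_I = 0` is required in degree `0`. -/
def cochains (p : ℕ) : Submodule K (HomI K g p × HomII K g p) where
  carrier := {P | p = 0 → P.1 = 0}
  add_mem' := by
    intro a b ha hb h
    simp [ha h, hb h]
  zero_mem' := fun _ => rfl
  smul_mem' := by
    intro c a ha h
    simp [ha h]

/-- The space of `p`-cochains: `Hom((∧²g)^{⊗p}, g) ⊕ Hom((∧²g)^{⊗p} ⊗ g, g)` for `p ≥ 1`, and
`Hom(g, g)` for `p = 0`. -/
def Cochain (p : ℕ) : Type _ := ↥(cochains K g p)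

instance (p : ℕ) : AddCommGroup (Cochain K g p) := inferInstanceAs (AddCommGroup (cochains K g p))

instance (p : ℕ) : Module K (Cochain K g p) := inferInstanceAs (Module K (cochains K g p))

variable {K g}

/-- The component `P_I` of a cochain. -/
def Cochain.I {p : ℕ} (P : Cochain K g p) : HomI K g p := P.1.1

/-- The component `P_II` of a cochain. -/
def Cochain.II {p : ℕ} (P : Cochain K g p) : HomII K g p := P.1.2

/-- The cochain with given components. -/
def Cochain.mk {p : ℕ} (A : HomI K g p) (B : HomII K g p) (h : p = 0 → A = 0) : Cochain K g p :=
  Subtype.mk (A, B) h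

theorem Cochain.ext {p : ℕ} {P Q : Cochain K g p} (hI : P.I = Q.I) (hII : P.II = Q.II) : P = Q :=
  Subtype.ext (Prod.ext hI hII)

variable (K g)

/-- The cochains of degree `0` are the endomorphisms of `g`. -/
def cochainZeroEquiv : Cochain K g 0 ≃ₗ[K] (g →ₗ[K] g) where
  toFun P := P.II ![]
  map_add' _ _ := rfl
  map_smul' _ _ := rfl
  invFun f := Cochain.mk 0 (MultilinearMap.constOfIsEmpty K _ f) fun _ => rfl
  left_inv P := by
    apply Cochain.ext
    · exact (P.2 rfl).symm
    · ext X : 1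
      change P.II ![] = P.II X
      congr 1
      exact Subsingleton.elim _ _
  right_inv _ := rfl

/-- A cochain of positive degree is an arbitrary pair `(P_I, P_II)`. -/
def cochainSuccEquiv (p : ℕ) : Cochain K g (p + 1) ≃ₗ[K] HomI K g (p + 1) × HomII K g (p + 1) where
  toFun P := (P.I, P.II)
  map_add' _ _ := rfl
  map_smul' _ _ := rfl
  invFun P := Cochain.mk P.1 P.2 fun h => absurd h (Nat.succ_ne_zero p)
  left_inv _ := rfl
  right_inv _ := rfl

variable {K g}

/-! ### The composition -/

/-- `(P ∘ Q)_I`. -/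
def compI {p q : ℕ} (P : Cochain K g p) (Q : Cochain K g q) : HomI K g (p + q) :=
  (∑ σ ∈ shufflesFixLast p q,
      ((-1 : K) ^ (p * q) * (Equiv.Perm.sign σ : ℤ)) • outerTerm LinearMap.id P.II Q.I σ) +
    ∑ k : Fin p, ∑ σ ∈ shuffles k q,
      ((-1 : K) ^ (k.val * q) * (Equiv.Perm.sign σ : ℤ)) • insertTerm P.I Q.II k σ

/-- `(P ∘ Q)_II`. -/
def compII {p q : ℕ} (P : Cochain K g p) (Q : Cochain K g q) : HomII K g (p + q) :=
  (∑ σ ∈ shuffles p q,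
      ((-1 : K) ^ (p * q) * (Equiv.Perm.sign σ : ℤ)) •
        outerTerm (LinearMap.llcomp K g g g) P.II Q.II σ) +
    ∑ k : Fin p, ∑ σ ∈ shuffles k q,
      ((-1 : K) ^ (k.val * q) * (Equiv.Perm.sign σ : ℤ)) • insertTerm P.II Q.II k σ

theorem compI_apply {p q : ℕ} (P : Cochain K g p) (Q : Cochain K g q)
    (X : Fin (p + q) → ⋀[K]^2 g) :
    compI P Q X =
      (∑ σ ∈ shufflesFixLast p q, ((-1 : K) ^ (p * q) * (Equiv.Perm.sign σ : ℤ)) •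
        P.II (fun i => X (σ (Fin.castAdd q i))) (Q.I fun j => X (σ (Fin.natAdd p j)))) +
      ∑ k : Fin p, ∑ σ ∈ shuffles k q, ((-1 : K) ^ (k.val * q) * (Equiv.Perm.sign σ : ℤ)) •
        P.I (Function.update (fun i => X (slotIdx q k σ i)) k
          (wedgeDer (Q.II fun j => X (firstIdx q k (σ (Fin.natAdd k j))))
            (X ⟨k + q, by omega⟩))) := by
  simp only [compI, _root_.add_apply, _root_.sum_apply,
    _root_.smul_apply]
  rfl

theorem compII_apply {p q : ℕ} (P : Cochain K g p) (Q : Cochain K g q)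
    (X : Fin (p + q) → ⋀[K]^2 g) (x : g) :
    compII P Q X x =
      (∑ σ ∈ shuffles p q, ((-1 : K) ^ (p * q) * (Equiv.Perm.sign σ : ℤ)) •
        P.II (fun i => X (σ (Fin.castAdd q i))) (Q.II (fun j => X (σ (Fin.natAdd p j))) x)) +
      ∑ k : Fin p, ∑ σ ∈ shuffles k q, ((-1 : K) ^ (k.val * q) * (Equiv.Perm.sign σ : ℤ)) •
        P.II (Function.update (fun i => X (slotIdx q k σ i)) k
          (wedgeDer (Q.II fun j => X (firstIdx q k (σ (Fin.natAdd k j))))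
            (X ⟨k + q, by omega⟩))) x := by
  simp only [compII, _root_.add_apply, _root_.sum_apply,
    _root_.smul_apply, LinearMap.add_apply, LinearMap.sum_apply, LinearMap.smul_apply]
  rfl

/-- The composition `P ∘ Q = ((P ∘ Q)_I, (P ∘ Q)_II)`. -/
def comp {p q : ℕ} (P : Cochain K g p) (Q : Cochain K g q) : Cochain K g (p + q) :=
  Cochain.mk (compI P Q) (compII P Q) (by
    intro h
    obtain ⟨rfl, rfl⟩ : p = 0 ∧ q = 0 := by omega
    have hQ : Q.I = 0 := Q.2 rfl
    ext X
    rw [compI_apply, hQ]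
    simp)

variable (K g)

/-- The composition as a bilinear map. -/
def compLin (p q : ℕ) : Cochain K g p →ₗ[K] Cochain K g q →ₗ[K] Cochain K g (p + q) :=
  LinearMap.mk₂ K comp
    (by
      intro P P' Q
      apply Cochain.ext
      · ext X
        change compI (P + P') Q X = compI P Q X + compI P' Q X
        have h1 : (P + P').I = P.I + P'.I := rfl
        have h2 : (P + P').II = P.II + P'.II := rfl
        simp only [compI_apply, h1, h2, _root_.add_apply, LinearMap.add_apply, smul_add,
          Finset.sum_add_distrib]
        abel
      · ext X x
        change compII (P + P') Q X x = compII P Q X x + compII P' Q X x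
        have h2 : (P + P').II = P.II + P'.II := rfl
        simp only [compII_apply, h2, _root_.add_apply, LinearMap.add_apply, smul_add,
          Finset.sum_add_distrib]
        abel)
    (by
      intro c P Q
      apply Cochain.ext
      · ext X
        change compI (c • P) Q X = c • compI P Q X
        have h1 : (c • P).I = c • P.I := rfl
        have h2 : (c • P).II = c • P.II := rfl
        simp only [compI_apply, h1, h2, _root_.smul_apply, LinearMap.smul_apply, smul_add,
          Finset.smul_sum, smul_comm c]
      · ext X x
        change compII (c • P) Q X x = c • compII P Q X x
        have h2 : (c • P).II = c • P.II := rfl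
        simp only [compII_apply, h2, _root_.smul_apply, LinearMap.smul_apply, smul_add,
          Finset.smul_sum, smul_comm c])
    (by
      intro P Q Q'
      apply Cochain.ext
      · ext X
        change compI P (Q + Q') X = compI P Q X + compI P Q' X
        have h1 : (Q + Q').I = Q.I + Q'.I := rfl
        have h2 : (Q + Q').II = Q.II + Q'.II := rfl
        simp only [compI_apply, h1, h2, _root_.add_apply, LinearMap.add_apply, map_add,
          MultilinearMap.map_update_add, smul_add, Finset.sum_add_distrib]
        abel
      · ext X x
        change compII P (Q + Q') X x = compII P Q X x + compII P Q' X x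
        have h2 : (Q + Q').II = Q.II + Q'.II := rfl
        simp only [compII_apply, h2, _root_.add_apply, LinearMap.add_apply, map_add,
          MultilinearMap.map_update_add, smul_add, Finset.sum_add_distrib]
        abel)
    (by
      intro c P Q
      apply Cochain.ext
      · ext X
        change compI P (c • Q) X = c • compI P Q X
        have h1 : (c • Q).I = c • Q.I := rfl
        have h2 : (c • Q).II = c • Q.II := rfl
        simp only [compI_apply, h1, h2, _root_.smul_apply, LinearMap.smul_apply, map_smul,
          MultilinearMap.map_update_smul, smul_add, Finset.smul_sum, smul_comm c]
      · ext X x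
        change compII P (c • Q) X x = c • compII P Q X x
        have h2 : (c • Q).II = c • Q.II := rfl
        simp only [compII_apply, h2, _root_.smul_apply, LinearMap.smul_apply, map_smul,
          MultilinearMap.map_update_smul, smul_add, Finset.smul_sum, smul_comm c])

/-- The bilinear extension to `⨁ p, Cochain K g p` of the graded commutator
`[P, Q] = P ∘ Q - (-1)^{pq} Q ∘ P`. -/
def lieYBracket :
    (⨁ p, Cochain K g p) →ₗ[K] (⨁ p, Cochain K g p) →ₗ[K] (⨁ p, Cochain K g p) :=
  DirectSum.toModule K ℕ _ fun p =>
    LinearMap.flip <| DirectSum.toModule K ℕ _ fun q => LinearMap.flip <|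
      (compLin K g p q).compr₂ (DirectSum.lof K ℕ (fun n => Cochain K g n) (p + q)) -
        (-1 : K) ^ (p * q) •
          (compLin K g q p).flip.compr₂ (DirectSum.lof K ℕ (fun n => Cochain K g n) (q + p))

theorem lieYBracket_lof {p q : ℕ} (P : Cochain K g p) (Q : Cochain K g q) :
    lieYBracket K g (DirectSum.lof K ℕ (fun n => Cochain K g n) p P)
        (DirectSum.lof K ℕ (fun n => Cochain K g n) q Q) =
      DirectSum.lof K ℕ (fun n => Cochain K g n) (p + q) (comp P Q) -
        (-1 : K) ^ (p * q) • DirectSum.lof K ℕ (fun n => Cochain K g n) (q + p) (comp Q P) := by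
  simp [lieYBracket, compLin]

end Cochains

/-! ### Graded Lie algebras and Maurer-Cartan elements -/

section Graded

variable (K : Type*) [CommRing K] (L : ℕ → Type*) [∀ p, AddCommGroup (L p)] [∀ p, Module K (L p)]

/-- The bilinear map `b` makes the graded vector space `⨁ p, L p` a graded Lie algebra: it is of
degree `0`, graded skew-symmetric, and satisfies the graded Jacobi identity. -/
structure IsGradedLieBracket (b : (⨁ p, L p) →ₗ[K] (⨁ p, L p) →ₗ[K] (⨁ p, L p)) : Prop where
  degree : ∀ (p q : ℕ) (x : L p) (y : L q), ∃ z : L (p + q),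
    b (DirectSum.lof K ℕ L p x) (DirectSum.lof K ℕ L q y) = DirectSum.lof K ℕ L (p + q) z
  skew : ∀ (p q : ℕ) (x : L p) (y : L q),
    b (DirectSum.lof K ℕ L p x) (DirectSum.lof K ℕ L q y) =
      -((-1 : K) ^ (p * q) • b (DirectSum.lof K ℕ L q y) (DirectSum.lof K ℕ L p x))
  jacobi : ∀ (p q r : ℕ) (x : L p) (y : L q) (z : L r),
    b (DirectSum.lof K ℕ L p x) (b (DirectSum.lof K ℕ L q y) (DirectSum.lof K ℕ L r z)) =
      b (b (DirectSum.lof K ℕ L p x) (DirectSum.lof K ℕ L q y)) (DirectSum.lof K ℕ L r z) +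
        (-1 : K) ^ (p * q) •
          b (DirectSum.lof K ℕ L q y) (b (DirectSum.lof K ℕ L p x) (DirectSum.lof K ℕ L r z))

variable {K L}

/-- A Maurer-Cartan element for the graded bracket `b` (with zero differential): an element `x` of
degree `1` with `[x, x] = 0`. -/
def IsMaurerCartan (b : (⨁ p, L p) →ₗ[K] (⨁ p, L p) →ₗ[K] (⨁ p, L p)) (x : L 1) : Prop :=
  b (DirectSum.lof K ℕ L 1 x) (DirectSum.lof K ℕ L 1 x) = 0

end Graded

/-! ### Lie-Yamaguti algebras -/

section LieYamaguti

variable {K : Type*} [CommRing K] {g : Type*} [AddCommGroup g] [Module K g]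

/-- The binary operation `π(x, y)` of a degree `1` cochain `Π = (π, ω)`. -/
def Cochain.bin (Φ : Cochain K g 1) (x y : g) : g := Φ.I fun _ => wedge K x y

/-- The ternary operation `ω(x, y, z)` of a degree `1` cochain `Π = (π, ω)`. -/
def Cochain.tri (Φ : Cochain K g 1) (x y z : g) : g := Φ.II (fun _ => wedge K x y) z

/-- The degree `1` cochain `(π, ω)`, with `π : ∧²g → g` and `ω : ∧²g ⊗ g → g`, defines a
Lie-Yamaguti algebra structure on `g`, with `[x, y] = π(x, y)` and `⟦x, y, z⟧ = ω(x, y, z)`. -/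
structure IsLieYamaguti (Φ : Cochain K g 1) : Prop where
  cyclic_bin : ∀ x y z : g,
    Φ.bin (Φ.bin x y) z + Φ.bin (Φ.bin y z) x + Φ.bin (Φ.bin z x) y +
      Φ.tri x y z + Φ.tri y z x + Φ.tri z x y = 0
  cyclic_tri : ∀ x y z w : g,
    Φ.tri (Φ.bin x y) z w + Φ.tri (Φ.bin y z) x w + Φ.tri (Φ.bin z x) y w = 0
  deriv_bin : ∀ x y z w : g,
    Φ.tri x y (Φ.bin z w) = Φ.bin (Φ.tri x y z) w + Φ.bin z (Φ.tri x y w)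
  deriv_tri : ∀ x y z w t : g,
    Φ.tri x y (Φ.tri z w t) =
      Φ.tri (Φ.tri x y z) w t + Φ.tri z (Φ.tri x y w) t + Φ.tri z w (Φ.tri x y t)

end LieYamaguti

end LieYamaguti

end

/-! The second component of a cochain is a function on words in ∧²g with values in End(g), and (P ∘
Q)_II has two parts. The shuffle sum is (-1)^{pq} times the shuffle product P * Q built on
composition of endomorphisms. The insertion sum is D_Q P, where D_Q replaces a letter X by Q(b) ⋆ X,
with b a subword of the letters before X. Hence (-1)^{pq} [P, Q]_II is the graded commutator
(`wordBracket`) of the product P · Q = P * Q - D_P Q (`wordAct`).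

The graded Jacobi identity follows once this product is graded left-symmetric: the commutator of P
and Q acts on R as P · (Q · R) - (-1)^{pq} Q · (P · R) (`wordAct_bracket`). That is formal from
three facts: * is associative (`shuffleMul_assoc`); D_P is a graded derivation of *
(`insertDer_shuffleMul`); and D carries the bracket to minus the graded commutator of derivations
(`insertDer_bracket`), because f ↦ f ⋆ · respects commutators.

For first components, the sum over shuffles fixing the last index is a half-shuffle product P ≻ Y,
in which the last letter goes to Y. It satisfies (P * Q) ≻ Y = P ≻ (Q ≻ Y), and D_P is a derivation
of it, so first components form a representation of the second ones (`halfWordAct_bracket`). The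
bracket on pairs is that of a semidirect product in which first components form an abelian ideal.

All of this is proved by induction on words, removing the last letter. `wordI_comp` and
`wordII_comp` translate the sums over permutations into this language; they rest on
`unshuffleSum_eq_sum_perm` and its variant with fixed last index.

In degree 1, [Π, Π] = 2 Π ∘ Π, so division by 2 reduces the Maurer-Cartan equation to Π ∘ Π = 0. On
a pair (X, Y) the two components of Π ∘ Π measure the failure of ω(X, ·) to be a derivation of π and
of ω. By linearity it suffices to test decomposable X and Y, which gives (c) and (d). -/

noncomputable section

namespace LieYamaguti

/-! ### Signed unshuffles of words -/

section Words

variable {L A B : Type*} [AddCommGroup A] [AddCommGroup B]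

/-- The signed sum of `F a b` over all ways to split the word `l` into two subwords `a` and `b`.
Words are read from right to left, so that the head of `l` is its last letter. -/
def unshuffleSum : List L → (List L → List L → A) → A
  | [], F => F [] []
  | X :: l, F => unshuffleSum l (fun a b => F a (X :: b)) +
      unshuffleSum l (fun a b => (-1 : ℤ) ^ b.length • F (X :: a) b)

theorem unshuffleSum_congr {l : List L} {F G : List L → List L → A}
    (h : ∀ a b, a.length + b.length = l.length → F a b = G a b) :
    unshuffleSum l F = unshuffleSum l G := by
  induction l generalizing F G with
  | nil => exact h [] [] rfl
  | cons X l ih =>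
    simp only [unshuffleSum]
    congr 1
    · exact ih fun a b hab => h _ _ (by simp; omega)
    · exact ih fun a b hab => by rw [h _ _ (by simp; omega)]

theorem unshuffleSum_add (l : List L) (F G : List L → List L → A) :
    unshuffleSum l (fun a b => F a b + G a b) = unshuffleSum l F + unshuffleSum l G := by
  induction l generalizing F G with
  | nil => rfl
  | cons X l ih =>
    simp only [unshuffleSum, smul_add, ih]
    abel

theorem map_unshuffleSum (φ : A →+ B) (l : List L) (F : List L → List L → A) :
    φ (unshuffleSum l F) = unshuffleSum l fun a b => φ (F a b) := by
  induction l generalizing F with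
  | nil => rfl
  | cons X l ih => simp only [unshuffleSum, map_add, ih, map_zsmul]

theorem unshuffleSum_zsmul (c : ℤ) (l : List L) (F : List L → List L → A) :
    unshuffleSum l (fun a b => c • F a b) = c • unshuffleSum l F :=
  (map_unshuffleSum (zsmulAddGroupHom c) l F).symm

theorem unshuffleSum_neg (l : List L) (F : List L → List L → A) :
    unshuffleSum l (fun a b => -F a b) = -unshuffleSum l F :=
  (map_unshuffleSum (-AddMonoidHom.id A) l F).symm

theorem unshuffleSum_sub (l : List L) (F G : List L → List L → A) :
    unshuffleSum l (fun a b => F a b - G a b) = unshuffleSum l F - unshuffleSum l G := by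
  simp only [sub_eq_add_neg, unshuffleSum_add, unshuffleSum_neg]

theorem unshuffleSum_zero (l : List L) : unshuffleSum l (fun _ _ => (0 : A)) = 0 := by
  simpa using unshuffleSum_zsmul 0 l (fun _ _ => (0 : A))

theorem unshuffleSum_ite (l : List L) (c : Prop) [Decidable c] (F : List L → List L → A) :
    unshuffleSum l (fun a b => if c then F a b else 0) = if c then unshuffleSum l F else 0 := by
  split_ifs
  · rfl
  · exact unshuffleSum_zero l

/-- Coassociativity of unshuffling: both sides run over the splittings of `l` into three subwords. A
last letter that goes to `a` passes both `b` and `d`, which is the sign (-1)^{|b| + |d|} on either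
side. -/
theorem unshuffleSum_assoc (l : List L) (F : List L → List L → List L → A) :
    unshuffleSum l (fun c d => unshuffleSum c fun a b => F a b d) =
      unshuffleSum l (fun a c => unshuffleSum c fun b d => F a b d) := by
  induction l generalizing F with
  | nil => rfl
  | cons X l ih =>
    simp only [unshuffleSum, smul_add, unshuffleSum_add, ih, ← unshuffleSum_zsmul, add_assoc]
    congr 2
    refine unshuffleSum_congr fun a c _ => unshuffleSum_congr fun b d h => ?_
    rw [← h, pow_add, mul_smul, smul_comm]

/-- The sign is that of the permutation exchanging two adjacent blocks of lengths |a| and |b|. -/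
theorem unshuffleSum_swap (l : List L) (F : List L → List L → A) :
    unshuffleSum l F =
      unshuffleSum l fun a b => (-1 : ℤ) ^ (a.length * b.length) • F b a := by
  induction l generalizing F with
  | nil => simp [unshuffleSum]
  | cons X l ih =>
    simp only [unshuffleSum]
    rw [add_comm, ih (fun a b => (-1 : ℤ) ^ b.length • F (X :: a) b),
      ih (fun a b => F a (X :: b))]
    congr 1
    · refine unshuffleSum_congr fun a b _ => ?_
      rw [← mul_smul, ← pow_add]
      congr 2
    · refine unshuffleSum_congr fun a b _ => ?_
      rw [← mul_smul, ← pow_add]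
      congr 1
      have : b.length + (X :: a).length * b.length = a.length * b.length + 2 * b.length := by
        simp; ring
      rw [this, pow_add, pow_mul (-1 : ℤ) 2]
      simp

end Words

/-! ### Shuffle products of cochains on words -/

section ShuffleProducts

variable {L E W : Type*} [Ring E] [AddCommGroup W]

/-- The function `P` on words is homogeneous of degree `p`. -/
def IsHomogeneous (p : ℕ) (P : List L → W) : Prop := ∀ l, l.length ≠ p → P l = 0

/-- The shuffle product of cochains on words. -/
def shuffleMul [Module E W] (P : List L → E) (Y : List L → W) (l : List L) : W :=
  unshuffleSum l fun a b => P a • Y b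

/-- The half-shuffle product of cochains on words: the last letter always goes to `Y`. -/
def halfShuffleMul [Module E W] (P : List L → E) (Y : List L → W) : List L → W
  | [] => 0
  | X :: l => shuffleMul P (fun l => Y (X :: l)) l

theorem isHomogeneous_shuffleMul [Module E W] {p q : ℕ} {P : List L → E} {Y : List L → W}
    (hP : IsHomogeneous p P) (hY : IsHomogeneous q Y) :
    IsHomogeneous (p + q) (shuffleMul P Y) := by
  intro l hl
  rw [shuffleMul, ← unshuffleSum_zero l]
  refine unshuffleSum_congr fun a b h => ?_
  by_cases ha : a.length = p
  · rw [hY b (by omega), smul_zero]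
  · rw [hP a ha, zero_smul]

theorem shuffleMul_assoc [Module E W] (P Q : List L → E) (Y : List L → W) (l : List L) :
    shuffleMul (shuffleMul P Q) Y l = shuffleMul P (shuffleMul Q Y) l := by
  have h1 : ∀ c d, (unshuffleSum c fun a b => P a • Q b) • Y d =
      unshuffleSum c fun a b => P a • Q b • Y d := by
    intro c d
    refine (map_unshuffleSum ((smulAddHom E W).flip (Y d)) c _).trans ?_
    simp [mul_smul]
  have h2 : ∀ a c, P a • (unshuffleSum c fun b d => Q b • Y d) =
      unshuffleSum c fun b d => P a • Q b • Y d := by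
    intro a c
    exact map_unshuffleSum (smulAddHom E W (P a)) c _
  unfold shuffleMul
  simp only [h1, h2]
  exact unshuffleSum_assoc l fun a b d => P a • Q b • Y d

end ShuffleProducts

/-! ### Derivations of cochains on words -/

section WordCochains

variable {L E W W' : Type*} [AddCommGroup L] [Ring E] [AddCommGroup W] [AddCommGroup W']
  (s : E →+ AddMonoid.End L)

/-- The function `Y` on words is additive in each letter. -/
def IsMultiadditive (Y : List L → W) : Prop :=
  ∀ l₁ l₂ x y, Y (l₁ ++ (x + y) :: l₂) = Y (l₁ ++ x :: l₂) + Y (l₁ ++ y :: l₂)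

theorem IsMultiadditive.cons {Y : List L → W} (h : IsMultiadditive Y) (X : L) :
    IsMultiadditive fun l => Y (X :: l) := fun l₁ => h (X :: l₁)

/-- The additive map given by the last letter. -/
def IsMultiadditive.lastHom {Y : List L → W} (h : IsMultiadditive Y) (l : List L) : L →+ W :=
  AddMonoidHom.mk' (fun x => Y (x :: l)) fun x y => h [] l x y

/-- The derivation given by a cochain `P` of degree `p`: it inserts `s (P b) X` in place of a
letter `X`, where `b` is a subword of length `p` of the word of letters before `X`. -/
def insertDer (p : ℕ) (P : List L → E) : (List L → W) → List L → W
  | _, [] => 0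
  | Y, X :: l => insertDer p P (fun l => Y (X :: l)) l +
      unshuffleSum l fun b a => if b.length = p then Y (s (P b) X :: a) else 0

theorem insertDer_add (p : ℕ) (P : List L → E) (Y Z : List L → W) (l : List L) :
    insertDer s p P (fun l => Y l + Z l) l = insertDer s p P Y l + insertDer s p P Z l := by
  induction l generalizing Y Z with
  | nil => simp [insertDer]
  | cons X l ih =>
    simp only [insertDer, ih]
    rw [add_add_add_comm, ← unshuffleSum_add]
    congr 2
    funext b a
    split_ifs <;> simp

theorem map_insertDer (φ : W →+ W') (p : ℕ) (P : List L → E) (Y : List L → W) (l : List L) :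
    φ (insertDer s p P Y l) = insertDer s p P (fun l => φ (Y l)) l := by
  induction l generalizing Y with
  | nil => simp [insertDer]
  | cons X l ih =>
    simp only [insertDer, map_add, ih, map_unshuffleSum]
    congr 2
    funext b a
    split_ifs <;> simp

theorem insertDer_zsmul (c : ℤ) (p : ℕ) (P : List L → E) (Y : List L → W) (l : List L) :
    insertDer s p P (fun l => c • Y l) l = c • insertDer s p P Y l :=
  (map_insertDer s (zsmulAddGroupHom c) p P Y l).symm

theorem insertDer_zero (p : ℕ) (P : List L → E) (l : List L) :
    insertDer s p P (fun _ => (0 : W)) l = 0 := by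
  simpa using insertDer_zsmul s 0 p P (fun _ => (0 : W)) l

theorem insertDer_sub (p : ℕ) (P : List L → E) (Y Z : List L → W) (l : List L) :
    insertDer s p P (fun l => Y l - Z l) l = insertDer s p P Y l - insertDer s p P Z l := by
  have h := insertDer_add s p P Y (fun l => (-1 : ℤ) • Z l) l
  rw [insertDer_zsmul] at h
  simpa [sub_eq_add_neg] using h

/-- D_P consumes `p` letters: on a word of length n it evaluates `Y` on words of length n - p, and n
- p has the parity of p + n. -/
theorem insertDer_sign (p : ℕ) (P : List L → E) (Y : List L → W) (l : List L) :
    insertDer s p P (fun l => (-1 : ℤ) ^ l.length • Y l) l =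
      (-1 : ℤ) ^ (p + l.length) • insertDer s p P Y l := by
  induction l generalizing Y with
  | nil => simp [insertDer]
  | cons X l ih =>
    have e : (fun l => (-1 : ℤ) ^ (X :: l).length • Y (X :: l)) =
        fun l : List L => (-1 : ℤ) • ((-1 : ℤ) ^ l.length • Y (X :: l)) := by
      funext l
      rw [← mul_smul, List.length_cons, pow_succ']
    simp only [insertDer]
    rw [e, insertDer_zsmul, ih, smul_add, ← unshuffleSum_zsmul, ← mul_smul]
    congr 1
    · congr 1
      rw [List.length_cons, ← add_assoc, pow_succ']
    · refine unshuffleSum_congr fun b a h => ?_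
      split_ifs with hb
      · congr 1
        have : p + (X :: l).length = 2 * p + (a.length + 1) := by simp; omega
        rw [this, pow_add, pow_mul]
        simp
      · simp

/-- The Leibniz rule. -/
theorem insertDer_unshuffleSum (p : ℕ) (P : List L → E) (F : List L → List L → W) (l : List L) :
    insertDer s p P (fun l => unshuffleSum l F) l =
      unshuffleSum l (fun a b => insertDer s p P (fun a => F a b) a) +
        unshuffleSum l (fun a b => (-1 : ℤ) ^ (p * a.length) • insertDer s p P (F a) b) := by
  induction l generalizing F with
  | nil => simp [insertDer, unshuffleSum]
  | cons X l ih =>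
    simp only [insertDer, unshuffleSum, insertDer_add, ih]
    have h1 : ∀ a b : List L, insertDer s p P (fun a => (-1 : ℤ) ^ b.length • F (X :: a) b) a =
        (-1 : ℤ) ^ b.length • insertDer s p P (fun a => F (X :: a) b) a :=
      fun a b => insertDer_zsmul s _ p P _ a
    have h2 : ∀ a b : List L,
        (-1 : ℤ) ^ (p * a.length) •
          insertDer s p P (fun b => (-1 : ℤ) ^ b.length • F (X :: a) b) b =
        (-1 : ℤ) ^ b.length • (-1 : ℤ) ^ (p * (X :: a).length) • insertDer s p P (F (X :: a)) b := by
      intro a b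
      rw [insertDer_sign, ← mul_smul, ← mul_smul, ← pow_add, ← pow_add]
      congr 2
      simp; ring
    -- The terms in which the last letter X is the one modified. They split the remaining letters
    -- into the argument c of P and the two parts a, b. If X lies in the second part, c has to move
    -- past a, which costs (-1)^{p|a|}; if X lies in the first part, c already stands next to it.
    have h3 : unshuffleSum l (fun c e => if c.length = p then
          (unshuffleSum e fun a b => F a (s (P c) X :: b)) +
            unshuffleSum e fun a b => (-1 : ℤ) ^ b.length • F (s (P c) X :: a) b else 0) =
        unshuffleSum l (fun a b => (-1 : ℤ) ^ (p * a.length) •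
          unshuffleSum b fun c e => if c.length = p then F a (s (P c) X :: e) else 0) +
        unshuffleSum l (fun a b => (-1 : ℤ) ^ b.length •
          unshuffleSum a fun c e => if c.length = p then F (s (P c) X :: e) b else 0) := by
      have e1 : ∀ c e : List L, (if c.length = p then
          (unshuffleSum e fun a b => F a (s (P c) X :: b)) +
            unshuffleSum e fun a b => (-1 : ℤ) ^ b.length • F (s (P c) X :: a) b else 0) =
          (unshuffleSum e fun a b => if c.length = p then F a (s (P c) X :: b) else 0) +
          (unshuffleSum e fun a b => if c.length = p then
            (-1 : ℤ) ^ b.length • F (s (P c) X :: a) b else 0) := by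
        intro c e
        rw [unshuffleSum_ite, unshuffleSum_ite]
        split_ifs <;> simp
      simp only [e1, unshuffleSum_add]
      congr 1
      · rw [← unshuffleSum_assoc l fun c a b => if c.length = p then F a (s (P c) X :: b) else 0]
        simp only [← unshuffleSum_zsmul]
        rw [← unshuffleSum_assoc l fun a c b => (-1 : ℤ) ^ (p * a.length) •
          if c.length = p then F a (s (P c) X :: b) else 0]
        refine unshuffleSum_congr fun d b _ => ?_
        rw [unshuffleSum_swap]
        refine unshuffleSum_congr fun a c _ => ?_
        split_ifs with h
        · rw [h, mul_comm]
        · simp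
      · rw [← unshuffleSum_assoc l fun c a b => if c.length = p then
            (-1 : ℤ) ^ b.length • F (s (P c) X :: a) b else 0]
        refine unshuffleSum_congr fun d b _ => ?_
        rw [← unshuffleSum_zsmul]
        refine unshuffleSum_congr fun a c _ => ?_
        split_ifs <;> simp
    simp only [h1, h2, h3, smul_add, unshuffleSum_add]
    abel

theorem isHomogeneous_insertDer {p q : ℕ} (P : List L → E) {Y : List L → W}
    (hY : IsHomogeneous q Y) : IsHomogeneous (p + q) (insertDer s p P Y) := by
  intro l
  induction l generalizing q Y with
  | nil => simp [insertDer]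
  | cons X l ih =>
    intro hl
    simp only [insertDer]
    have h2 : (unshuffleSum l fun b a => if b.length = p then Y (s (P b) X :: a) else 0) = 0 := by
      refine (unshuffleSum_congr fun b a h => ?_).trans (unshuffleSum_zero l)
      by_cases hb : b.length = p
      · rw [if_pos hb]
        refine hY _ fun h' => hl ?_
        simp at h' ⊢
        omega
      · rw [if_neg hb]
    rw [h2, add_zero]
    rcases q with _ | q
    · have : (fun l => Y (X :: l)) = fun _ => 0 := funext fun l => hY _ (by simp)
      rw [this, insertDer_zero]
    · refine ih (q := q) (fun l' hl' => hY _ (by simpa using hl')) ?_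
      simp at hl
      omega

/-- The Leibniz rule for pairings of the form P a • Y b; homogeneity of `Q` turns the sign
(-1)^{p|a|} into the constant (-1)^{pq}. -/
theorem insertDer_shuffleMul [Module E W] (p : ℕ) (P : List L → E) {q : ℕ} {Q : List L → E}
    (hQ : IsHomogeneous q Q) (Y : List L → W) (l : List L) :
    insertDer s p P (shuffleMul Q Y) l =
      shuffleMul (insertDer s p P Q) Y l +
        (-1 : ℤ) ^ (p * q) • shuffleMul Q (insertDer s p P Y) l := by
  unfold shuffleMul
  rw [insertDer_unshuffleSum, ← unshuffleSum_zsmul]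
  congr 1
  · refine unshuffleSum_congr fun a b _ => ?_
    exact (map_insertDer s ((smulAddHom E W).flip (Y b)) p P Q a).symm
  · refine unshuffleSum_congr fun a b _ => ?_
    by_cases ha : a.length = q
    · rw [ha]
      congr 1
      exact (map_insertDer s (smulAddHom E W (Q a)) p P Y b).symm
    · rw [hQ a ha]
      simp [insertDer_zero]

/-- The five terms record what happens to the last letter X: it is untouched; it is hit by Q, with P
inserted inside the argument of Q; it is hit by Q while P hits an earlier letter; it is hit by P
while Q hits an earlier letter; it is hit first by P and then by Q. -/
theorem insertDer_insertDer_cons (p q : ℕ) (P : List L → E) {Q : List L → E}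
    (hQ : IsHomogeneous q Q) {R : List L → W} (hR : IsMultiadditive R) (X : L) (l : List L) :
    insertDer s p P (insertDer s q Q R) (X :: l) =
      insertDer s p P (insertDer s q Q fun l => R (X :: l)) l +
      (unshuffleSum l fun b a =>
        if b.length = p + q then R (s (insertDer s p P Q b) X :: a) else 0) +
      (-1 : ℤ) ^ (p * q) • (unshuffleSum l fun b a =>
        if b.length = q then insertDer s p P (fun l => R (s (Q b) X :: l)) a else 0) +
      (unshuffleSum l fun b a =>
        if b.length = p then insertDer s q Q (fun l => R (s (P b) X :: l)) a else 0) +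
      (unshuffleSum l fun c a => unshuffleSum c fun b d =>
        if b.length = p ∧ d.length = q then R (s (Q d) (s (P b) X) :: a) else 0) := by
  simp only [insertDer, insertDer_add]
  rw [insertDer_unshuffleSum]
  simp only [add_assoc]
  congr 1
  congr 1
  · refine unshuffleSum_congr fun b a _ => ?_
    have h1 : (fun b => if b.length = q then R (s (Q b) X :: a) else 0) =
        fun b => ((hR.lastHom a).comp ((AddMonoidHom.eval X).comp s)) (Q b) := by
      funext b
      split_ifs with h
      · rfl
      · rw [hQ b h, map_zero]
    rw [h1, ← map_insertDer]
    split_ifs with h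
    · rfl
    · rw [isHomogeneous_insertDer s P hQ b h, map_zero]
  congr 1
  · rw [← unshuffleSum_zsmul]
    refine unshuffleSum_congr fun b a _ => ?_
    split_ifs with h
    · rw [h]
    · simp [insertDer_zero]
  · rw [unshuffleSum_assoc l fun b d a =>
      if b.length = p ∧ d.length = q then R (s (Q d) (s (P b) X) :: a) else 0,
      ← unshuffleSum_add]
    refine unshuffleSum_congr fun b a _ => ?_
    split_ifs with h
    · simp [h]
    · simp [h, unshuffleSum_zero]

/-- The action `Y ↦ P · Y - D_P Y` of a cochain `P` of degree `p`. -/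
def wordAct [Module E W] (p : ℕ) (P : List L → E) (Y : List L → W) (l : List L) : W :=
  shuffleMul P Y l - insertDer s p P Y l

/-- The action `Y ↦ P ≻ Y - D_P Y` of a cochain `P` of degree `p`, where `≻` is the half-shuffle
product. -/
def halfWordAct [Module E W] (p : ℕ) (P : List L → E) (Y : List L → W) (l : List L) : W :=
  halfShuffleMul P Y l - insertDer s p P Y l

/-- The graded commutator of the product `wordAct`. -/
def wordBracket (p q : ℕ) (P Q : List L → E) (l : List L) : E :=
  wordAct s p P Q l - (-1 : ℤ) ^ (p * q) • wordAct s q Q P l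

/-- In the graded commutator of D_P and D_Q, the terms that hit two separate letters cancel. What
survives is nested insertion, which gives D of D_P Q and of D_Q P, and two successive actions on one
letter, which `hs` turns into the commutator of the shuffle products. -/
theorem insertDer_bracket (hs : ∀ f g x, s (f * g - g * f) x = s f (s g x) - s g (s f x))
    {p q : ℕ} {P Q : List L → E} (hP : IsHomogeneous p P) (hQ : IsHomogeneous q Q)
    {R : List L → W} (hR : IsMultiadditive R) (l : List L) :
    insertDer s (p + q) (wordBracket s p q P Q) R l =
      (-1 : ℤ) ^ (p * q) • insertDer s q Q (insertDer s p P R) l -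
        insertDer s p P (insertDer s q Q R) l := by
  induction l generalizing R with
  | nil => simp [insertDer]
  | cons X l ih =>
    rw [insertDer_insertDer_cons s p q P hQ hR, insertDer_insertDer_cons s q p Q hP hR, insertDer,
      ih (hR.cons X)]
    -- The part where X is modified by everything at once. It is compared for each fixed remainder
    -- `a`, so that only the word `c` of letters consumed by P and Q matters.
    have key : (unshuffleSum l fun b a =>
          if b.length = p + q then R (s (wordBracket s p q P Q b) X :: a) else 0) =
        (-1 : ℤ) ^ (p * q) • (unshuffleSum l fun b a =>
          if b.length = q + p then R (s (insertDer s q Q P b) X :: a) else 0) -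
        (unshuffleSum l fun b a =>
          if b.length = p + q then R (s (insertDer s p P Q b) X :: a) else 0) +
        (-1 : ℤ) ^ (p * q) • (unshuffleSum l fun c a => unshuffleSum c fun b d =>
          if b.length = q ∧ d.length = p then R (s (P d) (s (Q b) X) :: a) else 0) -
        (unshuffleSum l fun c a => unshuffleSum c fun b d =>
          if b.length = p ∧ d.length = q then R (s (Q d) (s (P b) X) :: a) else 0) := by
      simp only [← unshuffleSum_zsmul, ← unshuffleSum_add, ← unshuffleSum_sub]
      refine unshuffleSum_congr fun c a _ => ?_
      have hdeg : ∀ p q, ∀ P Q : List L → E, c.length ≠ p + q →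
          (unshuffleSum c fun b d =>
            if b.length = p ∧ d.length = q then R (s (Q d) (s (P b) X) :: a) else 0) = 0 := by
        intro p q P Q hc
        refine (unshuffleSum_congr fun b d h => ?_).trans (unshuffleSum_zero c)
        rw [if_neg]
        omega
      by_cases hc : c.length = p + q
      swap
      · rw [hdeg p q P Q hc, unshuffleSum_zsmul, hdeg q p Q P (by omega), if_neg hc, if_neg hc,
          if_neg (by omega)]
        simp
      have hc' : c.length = q + p := by omega
      set φ : E →+ W := (hR.lastHom a).comp ((AddMonoidHom.eval X).comp s) with hφ
      have e0 : ∀ f, R (s f X :: a) = φ f := fun f => rfl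
      rw [if_pos hc, if_pos hc', if_pos hc, e0, e0, e0]
      have e1 : (unshuffleSum c fun b d =>
          if b.length = p ∧ d.length = q then R (s (Q d) (s (P b) X) :: a) else 0) =
          unshuffleSum c fun b d => hR.lastHom a (s (Q d) (s (P b) X)) := by
        refine unshuffleSum_congr fun b d h => ?_
        by_cases hb : b.length = p
        · rw [if_pos (by omega)]
          rfl
        · rw [if_neg (by omega), hP b hb]
          simp
      have e2 : (unshuffleSum c fun b d => (-1 : ℤ) ^ (p * q) •
          if b.length = q ∧ d.length = p then R (s (P d) (s (Q b) X) :: a) else 0) =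
          unshuffleSum c fun b d => hR.lastHom a (s (P b) (s (Q d) X)) := by
        rw [unshuffleSum_swap]
        refine unshuffleSum_congr fun b d h => ?_
        by_cases hb : b.length = p
        · have hd : d.length = q := by omega
          rw [if_pos ⟨hd, hb⟩, hb, hd, ← mul_smul, ← mul_pow]
          simp
          rfl
        · rw [if_neg (by omega), hP b hb]
          simp
      have e3 : (-1 : ℤ) ^ (p * q) • φ (shuffleMul Q P c) =
          unshuffleSum c fun b d => φ (Q d * P b) := by
        rw [shuffleMul, map_unshuffleSum, ← unshuffleSum_zsmul, unshuffleSum_swap]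
        refine unshuffleSum_congr fun b d h => ?_
        by_cases hb : b.length = p
        · have hd : d.length = q := by omega
          rw [hb, hd, ← mul_smul, ← mul_pow]
          simp
        · rw [hP b hb]
          simp
      have e4 : φ (shuffleMul P Q c) = unshuffleSum c fun b d => φ (P b * Q d) := by
        rw [shuffleMul, map_unshuffleSum]
        rfl
      -- The only place where compatibility of `s` with commutators is used.
      have e5 : (unshuffleSum c fun b d => φ (P b * Q d)) -
          (unshuffleSum c fun b d => φ (Q d * P b)) =
          (unshuffleSum c fun b d => hR.lastHom a (s (P b) (s (Q d) X))) -
          (unshuffleSum c fun b d => hR.lastHom a (s (Q d) (s (P b) X))) := by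
        rw [← unshuffleSum_sub, ← unshuffleSum_sub]
        refine unshuffleSum_congr fun b d _ => ?_
        rw [← map_sub, ← map_sub, ← hs]
        rfl
      simp only [wordBracket, wordAct, map_sub, map_zsmul, smul_sub]
      rw [e1, e2, e3, e4, sub_sub_eq_add_sub, add_sub_right_comm, sub_right_comm, e5]
      abel
    rw [key]
    have e : (-1 : ℤ) ^ (p * q) * (-1 : ℤ) ^ (q * p) = 1 := by
      rw [mul_comm q p, ← mul_pow]
      simp
    simp only [smul_add, ← mul_smul, e, one_smul]
    abel

/-- With the last letter X reserved for `Y`, insertions at earlier letters obey the Leibniz rule of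
the full shuffle product. An insertion at X acts on `Y` alone, so there only the order of the
arguments of P and Q has to be exchanged. -/
theorem insertDer_halfShuffleMul [Module E W] (p : ℕ) (P : List L → E)
    {q : ℕ} {Q : List L → E} (hQ : IsHomogeneous q Q) (Y : List L → W) (l : List L) :
    insertDer s p P (halfShuffleMul Q Y) l =
      halfShuffleMul (insertDer s p P Q) Y l +
        (-1 : ℤ) ^ (p * q) • halfShuffleMul Q (insertDer s p P Y) l := by
  rcases l with _ | ⟨X, l⟩
  · simp [insertDer, halfShuffleMul]
  simp only [insertDer, halfShuffleMul]
  have h := insertDer_shuffleMul s p P hQ (fun l => Y (X :: l)) l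
  rw [show (fun l => shuffleMul Q (fun l => Y (X :: l)) l) =
    shuffleMul Q (fun l => Y (X :: l)) from rfl, h, add_assoc]
  congr 1
  have hadd : shuffleMul Q (fun l => insertDer s p P (fun l => Y (X :: l)) l +
      unshuffleSum l fun b a => if b.length = p then Y (s (P b) X :: a) else 0) l =
      shuffleMul Q (insertDer s p P (fun l => Y (X :: l))) l +
      shuffleMul Q (fun l => unshuffleSum l fun b a =>
        if b.length = p then Y (s (P b) X :: a) else 0) l := by
    simp only [shuffleMul, smul_add, unshuffleSum_add]
  rw [hadd, smul_add]
  congr 1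
  have h1 : (unshuffleSum l fun b a => if b.length = p then
      shuffleMul Q (fun l => Y (s (P b) X :: l)) a else 0) =
      unshuffleSum l fun b c => unshuffleSum c fun d a =>
        if b.length = p then Q d • Y (s (P b) X :: a) else 0 := by
    refine unshuffleSum_congr fun b a _ => ?_
    rw [unshuffleSum_ite]
    rfl
  have h2 : shuffleMul Q (fun l => unshuffleSum l fun b a =>
        if b.length = p then Y (s (P b) X :: a) else 0) l =
      unshuffleSum l fun d c => unshuffleSum c fun b a =>
        if b.length = p then Q d • Y (s (P b) X :: a) else 0 := by
    refine unshuffleSum_congr fun d c _ => ?_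
    refine (map_unshuffleSum (smulAddHom E W (Q d)) c _).trans ?_
    refine unshuffleSum_congr fun b a _ => ?_
    split_ifs <;> simp
  rw [h1, h2, ← unshuffleSum_assoc l fun b d a =>
      if b.length = p then Q d • Y (s (P b) X :: a) else 0,
    ← unshuffleSum_assoc l fun d b a => if b.length = p then Q d • Y (s (P b) X :: a) else 0,
    ← unshuffleSum_zsmul]
  refine unshuffleSum_congr fun c a _ => ?_
  rw [unshuffleSum_swap, ← unshuffleSum_zsmul]
  refine unshuffleSum_congr fun d b _ => ?_
  split_ifs with hb
  · by_cases hd : d.length = q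
    · rw [hb, hd, mul_comm p q]
    · simp [hQ d hd]
  · simp

theorem wordAct_sub [Module E W] (p : ℕ) (P : List L → E) (Y Z : List L → W) (l : List L) :
    wordAct s p P (fun l => Y l - Z l) l = wordAct s p P Y l - wordAct s p P Z l := by
  simp only [wordAct, insertDer_sub, shuffleMul, smul_sub, unshuffleSum_sub]
  abel

/-- Expanding (P - D_P)(Q - D_Q) by the Leibniz rule, the mixed terms Q * D_P R and P * D_Q R cancel
in the graded commutator. Associativity and `insertDer_bracket` identify the rest. -/
theorem wordAct_bracket [Module E W]
    (hs : ∀ f g x, s (f * g - g * f) x = s f (s g x) - s g (s f x))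
    {p q : ℕ} {P Q : List L → E} (hP : IsHomogeneous p P) (hQ : IsHomogeneous q Q)
    {R : List L → W} (hR : IsMultiadditive R) (l : List L) :
    wordAct s (p + q) (wordBracket s p q P Q) R l =
      wordAct s p P (wordAct s q Q R) l -
        (-1 : ℤ) ^ (p * q) • wordAct s q Q (wordAct s p P R) l := by
  have hmul : shuffleMul (wordBracket s p q P Q) R l =
      shuffleMul (shuffleMul P Q) R l - shuffleMul (insertDer s p P Q) R l -
      (-1 : ℤ) ^ (p * q) • (shuffleMul (shuffleMul Q P) R l -
        shuffleMul (insertDer s q Q P) R l) := by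
    rw [shuffleMul, shuffleMul, shuffleMul, shuffleMul, shuffleMul]
    simp only [wordBracket, wordAct, sub_smul, unshuffleSum_sub, smul_assoc, unshuffleSum_zsmul]
  have e : (-1 : ℤ) ^ (p * q) * (-1 : ℤ) ^ (q * p) = 1 := by
    rw [mul_comm q p, ← mul_pow]
    simp
  rw [wordAct, hmul, insertDer_bracket s hs hP hQ hR]
  rw [show wordAct s q Q R = fun l => shuffleMul Q R l - insertDer s q Q R l from rfl,
    show wordAct s p P R = fun l => shuffleMul P R l - insertDer s p P R l from rfl,
    wordAct_sub, wordAct_sub]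
  simp only [wordAct]
  rw [insertDer_shuffleMul s p P hQ, insertDer_shuffleMul s q Q hP, ← shuffleMul_assoc,
    ← shuffleMul_assoc]
  simp only [smul_add, smul_sub, ← mul_smul, e, one_smul]
  abel

/-- The computation for the full shuffle product carries over, with associativity replaced by (P *
Q) ≻ R = P ≻ (Q ≻ R): since the last letter goes to R on both sides, this is associativity on the
word before it. -/
theorem halfWordAct_bracket [Module E W]
    (hs : ∀ f g x, s (f * g - g * f) x = s f (s g x) - s g (s f x))
    {p q : ℕ} {P Q : List L → E} (hP : IsHomogeneous p P) (hQ : IsHomogeneous q Q)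
    {R : List L → W} (hR : IsMultiadditive R) (l : List L) :
    halfWordAct s (p + q) (wordBracket s p q P Q) R l =
      halfWordAct s p P (halfWordAct s q Q R) l -
        (-1 : ℤ) ^ (p * q) • halfWordAct s q Q (halfWordAct s p P R) l := by
  have hhalf : ∀ (P' : List L → E) (Y Z : List L → W), halfShuffleMul P' (fun l => Y l - Z l) l =
      halfShuffleMul P' Y l - halfShuffleMul P' Z l := by
    intro P' Y Z
    rcases l with _ | ⟨X, l⟩
    · simp [halfShuffleMul]
    · simp only [halfShuffleMul, shuffleMul, smul_sub, unshuffleSum_sub]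
  have hassoc : ∀ (P Q : List L → E), halfShuffleMul (shuffleMul P Q) R l =
      halfShuffleMul P (halfShuffleMul Q R) l := by
    intro P Q
    rcases l with _ | ⟨X, l⟩
    · simp [halfShuffleMul]
    · exact shuffleMul_assoc P Q (fun l => R (X :: l)) l
  have hmul : halfShuffleMul (wordBracket s p q P Q) R l =
      halfShuffleMul (shuffleMul P Q) R l - halfShuffleMul (insertDer s p P Q) R l -
      (-1 : ℤ) ^ (p * q) • (halfShuffleMul (shuffleMul Q P) R l -
        halfShuffleMul (insertDer s q Q P) R l) := by
    rcases l with _ | ⟨X, l⟩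
    · simp [halfShuffleMul]
    · simp only [halfShuffleMul]
      rw [shuffleMul, shuffleMul, shuffleMul, shuffleMul, shuffleMul]
      simp only [wordBracket, wordAct, sub_smul, unshuffleSum_sub, smul_assoc, unshuffleSum_zsmul]
  have e : (-1 : ℤ) ^ (p * q) * (-1 : ℤ) ^ (q * p) = 1 := by
    rw [mul_comm q p, ← mul_pow]
    simp
  rw [halfWordAct, hmul, insertDer_bracket s hs hP hQ hR]
  rw [show halfWordAct s q Q R = fun l => halfShuffleMul Q R l - insertDer s q Q R l from rfl,
    show halfWordAct s p P R = fun l => halfShuffleMul P R l - insertDer s p P R l from rfl]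
  simp only [halfWordAct, hhalf, insertDer_sub]
  rw [insertDer_halfShuffleMul s p P hQ, insertDer_halfShuffleMul s q Q hP, ← hassoc,
    ← hassoc]
  simp only [smul_add, smul_sub, ← mul_smul, e, one_smul]
  abel

end WordCochains

/-! ### Shuffles and unshuffles of words -/

section PermShuffles

/-- `σ` is increasing on the indices `< p` and on the indices `≥ p`. -/
def IncreasingAt {n : ℕ} (p : ℕ) (σ : Equiv.Perm (Fin n)) : Prop :=
  ∀ i j : Fin n, i < j → (j.val < p ∨ p ≤ i.val) → σ i < σ j

instance {n : ℕ} (p : ℕ) : DecidablePred (IncreasingAt (n := n) p) := fun _ =>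
  inferInstanceAs (Decidable (∀ _ _, _))

/-- `IncreasingAt` makes sense on `Fin n` without a decomposition n = p + q, which permits induction
on n. -/
theorem isShuffle_iff (p q : ℕ) (σ : Equiv.Perm (Fin (p + q))) :
    IsShuffle p q σ ↔ IncreasingAt p σ := by
  constructor
  · rintro ⟨h1, h2⟩ i j hij h
    induction i using Fin.addCases with
    | left i =>
      induction j using Fin.addCases with
      | left j => exact h1 i j (Fin.lt_def.2 (by simpa using Fin.lt_def.1 hij))
      | right j => simp at h; omega
    | right i =>
      induction j using Fin.addCases with
      | left j =>
        simp only [Fin.lt_def, Fin.val_natAdd, Fin.val_castAdd] at hij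
        omega
      | right j => exact h2 i j (Fin.lt_def.2 (by simpa using Fin.lt_def.1 hij))
  · intro h
    exact ⟨fun i j hij => h _ _ (Fin.lt_def.2 (by simpa using Fin.lt_def.1 hij)) (Or.inl (by simp)),
      fun i j hij => h _ _ (Fin.lt_def.2 (by simpa using Fin.lt_def.1 hij)) (Or.inr (by simp))⟩

/-- The permutation of `Fin (n + 1)` which maps `m` to the last element and is given by `τ` on the
other elements. -/
def insertLast {n : ℕ} (m : Fin (n + 1)) (τ : Equiv.Perm (Fin n)) : Equiv.Perm (Fin (n + 1)) :=
  finSuccEquivLast.symm.permCongr (Equiv.optionCongr τ) * (Fin.cycleIcc m (Fin.last n))⁻¹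

theorem insertLast_self {n : ℕ} (m : Fin (n + 1)) (τ : Equiv.Perm (Fin n)) :
    insertLast m τ m = Fin.last n := by
  have h : (Fin.cycleIcc m (Fin.last n))⁻¹ m = Fin.last n := by
    rw [Equiv.Perm.inv_eq_iff_eq, Fin.cycleIcc_of_last (Fin.le_last m)]
  rw [insertLast, Equiv.Perm.mul_apply, h]
  simp

theorem insertLast_succAbove {n : ℕ} (m : Fin (n + 1)) (τ : Equiv.Perm (Fin n)) (j : Fin n) :
    insertLast m τ (m.succAbove j) = (τ j).castSucc := by
  have h : (Fin.cycleIcc m (Fin.last n))⁻¹ (m.succAbove j) = j.castSucc := by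
    rw [Equiv.Perm.inv_eq_iff_eq, ← Fin.cycleIcc_comp_succAbove m _ (Fin.le_last m)]
    simp [-Fin.cycleIcc_def_le]
  rw [insertLast, Equiv.Perm.mul_apply, h]
  simp

theorem sign_insertLast {n : ℕ} (m : Fin (n + 1)) (τ : Equiv.Perm (Fin n)) :
    (Equiv.Perm.sign (insertLast m τ) : ℤ) = (-1) ^ (n - m.val) * (Equiv.Perm.sign τ : ℤ) := by
  have h := Fin.sign_cycleIcc_of_le (Fin.le_last m)
  simp only [insertLast, Equiv.Perm.sign_mul, Equiv.Perm.sign_inv, h, Equiv.Perm.sign_permCongr,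
    Equiv.optionCongr_sign]
  simp [mul_comm]

/-- The index `m` is recovered as the preimage of the last element; surjectivity follows by
counting, (n + 1)! = (n + 1) · n!. -/
theorem insertLast_bijective (n : ℕ) :
    Function.Bijective fun x : Fin (n + 1) × Equiv.Perm (Fin n) => insertLast x.1 x.2 := by
  rw [Fintype.bijective_iff_injective_and_card]
  constructor
  · rintro ⟨m, τ⟩ ⟨m', τ'⟩ h
    dsimp only at h
    have hm : m = m' := by
      apply (insertLast m τ).injective
      rw [insertLast_self, h, insertLast_self]
    subst hm
    congr 1
    ext j
    have := congrArg Fin.val (DFunLike.congr_fun h (m.succAbove j))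
    simpa [insertLast_succAbove] using this
  · simp [Fintype.card_perm, Nat.factorial_succ]

/-- A permutation increasing on two blocks takes its largest value at the end of one of them, at
position n or p - 1. The condition `p ≤ n` excludes an empty second block, so that the two cases are
disjoint. -/
theorem increasingAt_insertLast_iff {n p : ℕ} (hp : p ≤ n + 1) (m : Fin (n + 1))
    (τ : Equiv.Perm (Fin n)) :
    IncreasingAt p (insertLast m τ) ↔
      (m = Fin.last n ∧ p ≤ n ∧ IncreasingAt p τ) ∨ (m.val + 1 = p ∧ IncreasingAt (p - 1) τ) := by
  have hval : ∀ j : Fin n, (m.succAbove j).val = if j.val < m.val then j.val else j.val + 1 := by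
    intro j
    simp only [Fin.succAbove, Fin.lt_def, Fin.val_castSucc]
    split_ifs <;> simp
  have hlt : ∀ i j, i < j → m.succAbove i < m.succAbove j := fun i j h =>
    Fin.strictMono_succAbove m h
  constructor
  · intro h
    have hr : ∀ i j : Fin n, i < j →
        ((m.succAbove j).val < p ∨ p ≤ (m.succAbove i).val) → τ i < τ j := by
      intro i j hij hb
      have := h _ _ (hlt i j hij) hb
      rwa [insertLast_succAbove, insertLast_succAbove, Fin.castSucc_lt_castSucc_iff] at this
    by_cases hmp : m.val + 1 = p
    · right
      refine ⟨hmp, fun i j hij hb => hr i j hij ?_⟩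
      rw [hval, hval]
      split_ifs <;> omega
    · left
      have hm : m = Fin.last n := by
        by_contra hm
        have hm' : m.val < n := by
          have := Fin.val_lt_last hm
          simpa using this
        have := h m ⟨m.val + 1, by omega⟩ (by simp [Fin.lt_def]) (by simp; omega)
        rw [insertLast_self] at this
        exact absurd this (Fin.not_lt.2 (Fin.le_last _))
      subst hm
      simp at hmp
      refine ⟨rfl, by omega, fun i j hij hb => hr i j hij ?_⟩
      simpa using hb
  · intro h i j hij hb
    rcases Fin.eq_self_or_eq_succAbove m j with rfl | ⟨j, rfl⟩
    · obtain ⟨i, rfl⟩ := Fin.exists_succAbove_eq hij.ne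
      rw [insertLast_self, insertLast_succAbove]
      exact Fin.castSucc_lt_last _
    · rcases Fin.eq_self_or_eq_succAbove m i with rfl | ⟨i, rfl⟩
      · exfalso
        rcases h with ⟨rfl, _, _⟩ | ⟨h, _⟩
        · exact absurd hij (Fin.not_lt.2 (Fin.le_last _))
        · rw [Fin.lt_def] at hij
          omega
      · rw [insertLast_succAbove, insertLast_succAbove, Fin.castSucc_lt_castSucc_iff]
        have hij' : i < j := (Fin.strictMono_succAbove m).lt_iff_lt.1 hij
        rw [hval, hval] at hb
        rcases h with ⟨rfl, _, h⟩ | ⟨hm, h⟩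
        · refine h i j hij' ?_
          simpa using hb
        · refine h i j hij' ?_
          split_ifs at hb <;> omega

theorem take_succ_insert {α : Type*} (l : List α) (x : α) {m : ℕ} (hm : m ≤ l.length) :
    (l.take m ++ x :: l.drop m).take (m + 1) = l.take m ++ [x] := by
  rw [List.take_append, List.take_of_length_le (by simp)]
  have : m + 1 - (l.take m).length = 1 := by simp [hm]
  rw [this]
  simp

theorem drop_succ_insert {α : Type*} (l : List α) (x : α) {m : ℕ} (hm : m ≤ l.length) :
    (l.take m ++ x :: l.drop m).drop (m + 1) = l.drop m := by
  rw [List.drop_append, List.drop_of_length_le (by simp)]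
  have : m + 1 - (l.take m).length = 1 := by simp [hm]
  rw [this]
  simp

variable {L A : Type*} [AddCommGroup A]

theorem ofFn_comp_insertLast {n : ℕ} (m : Fin (n + 1)) (τ : Equiv.Perm (Fin n))
    (X : Fin (n + 1) → L) :
    (List.ofFn fun i => X (insertLast m τ i)) =
      (List.ofFn fun i => X (τ i).castSucc).take m.val ++
        X (Fin.last n) :: (List.ofFn fun i => X (τ i).castSucc).drop m.val := by
  have hm := m.isLt
  apply List.ext_getElem
  · simp; omega
  · intro i h1 h2
    simp only [List.length_ofFn] at h1
    rw [List.getElem_ofFn]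
    rcases Fin.eq_self_or_eq_succAbove m ⟨i, h1⟩ with h | ⟨j, h⟩
    · rw [h, insertLast_self, List.getElem_append_right (by simp [← h])]
      have : i - min i n = 0 := by omega
      simp [← h, this]
    · rw [h, insertLast_succAbove]
      have hv := congrArg Fin.val h
      simp only [Fin.succAbove, Fin.lt_def, Fin.val_castSucc] at hv
      split_ifs at hv with hj
      · simp only [Fin.val_castSucc] at hv
        subst hv
        rw [List.getElem_append_left (by simp; omega)]
        simp
      · simp only [Fin.val_succ] at hv
        subst hv
        rw [List.getElem_append_right (by simp; omega)]
        simp only [List.length_take, List.length_ofFn]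
        have : j.val + 1 - min m.val n = (j.val - m.val) + 1 := by omega
        simp only [this, List.getElem_cons_succ, List.getElem_drop, List.getElem_ofFn]
        congr 3
        apply Fin.ext
        simp
        omega

/-- The position of the largest value decides whether the last letter goes to the first or the
second subword, which is the recursion of `unshuffleSum`. In the first case the sign of the cycle is
(-1)^{n - (p - 1)} = (-1)^{|b|}. -/
theorem unshuffleSum_eq_sum_perm {n p : ℕ} (hp : p ≤ n) (X : Fin n → L)
    (F : List L → List L → A) :
    unshuffleSum (List.ofFn X).reverse (fun a b => if a.length = p then F a b else 0) =
      ∑ σ : Equiv.Perm (Fin n), if IncreasingAt p σ then (Equiv.Perm.sign σ : ℤ) •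
        F ((List.ofFn fun i => X (σ i)).take p).reverse
          ((List.ofFn fun i => X (σ i)).drop p).reverse else 0 := by
  induction n generalizing p F with
  | zero =>
    obtain rfl : p = 0 := by omega
    rw [Fintype.sum_unique, if_pos]
    · simp [unshuffleSum]
    · intro i
      exact i.elim0
  | succ n ih =>
    rw [← (insertLast_bijective n).sum_comp, Fintype.sum_prod_type]
    have hrev : (List.ofFn X).reverse =
        X (Fin.last n) :: (List.ofFn fun i : Fin n => X i.castSucc).reverse := by
      rw [List.ofFn_succ', List.concat_eq_append, List.reverse_append]
      rfl
    rw [hrev, unshuffleSum]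
    have hsplit : ∀ (m : Fin (n + 1)) (τ : Equiv.Perm (Fin n)),
        (if IncreasingAt p (insertLast m τ) then (Equiv.Perm.sign (insertLast m τ) : ℤ) •
          F ((List.ofFn fun i => X (insertLast m τ i)).take p).reverse
            ((List.ofFn fun i => X (insertLast m τ i)).drop p).reverse else 0) =
        (if m = Fin.last n then if p ≤ n then if IncreasingAt p τ then
          (Equiv.Perm.sign τ : ℤ) • F ((List.ofFn fun i => X (τ i).castSucc).take p).reverse
            (X (Fin.last n) :: ((List.ofFn fun i => X (τ i).castSucc).drop p).reverse)
          else 0 else 0 else 0) +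
        (if m.val + 1 = p then if IncreasingAt (p - 1) τ then
          (Equiv.Perm.sign τ : ℤ) • (-1 : ℤ) ^ (n - (p - 1)) •
            F (X (Fin.last n) :: ((List.ofFn fun i => X (τ i).castSucc).take (p - 1)).reverse)
              ((List.ofFn fun i => X (τ i).castSucc).drop (p - 1)).reverse
          else 0 else 0) := by
      intro m τ
      simp only [increasingAt_insertLast_iff hp, ofFn_comp_insertLast, sign_insertLast]
      by_cases hm : m.val + 1 = p
      · subst hm
        have h1 : ¬ (m = Fin.last n ∧ m.val + 1 ≤ n ∧ IncreasingAt (m.val + 1) τ) := by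
          rintro ⟨rfl, h, _⟩
          simp at h
        have h2 : (if m = Fin.last n then if m.val + 1 ≤ n then if IncreasingAt (m.val + 1) τ then
          (Equiv.Perm.sign τ : ℤ) •
            F ((List.ofFn fun i => X (τ i).castSucc).take (m.val + 1)).reverse
            (X (Fin.last n) :: ((List.ofFn fun i => X (τ i).castSucc).drop (m.val + 1)).reverse)
          else 0 else 0 else 0) = 0 := by
          split_ifs with a b c
          · exact absurd ⟨a, b, c⟩ h1
          all_goals rfl
        rw [h2]
        rw [take_succ_insert _ _ (by simp; omega), drop_succ_insert _ _ (by simp; omega)]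
        simp only [h1, false_or, true_and, zero_add, if_true, Nat.add_sub_cancel,
          List.reverse_append, List.reverse_cons, List.reverse_nil, List.nil_append,
          List.singleton_append]
        congr 1
        rw [mul_smul, smul_comm]
      · by_cases hl : m = Fin.last n
        · subst hl
          have hpn : p ≤ n := by
            simp only [Fin.val_last] at hm
            omega
          have h0 : p - n = 0 := by omega
          rw [List.take_of_length_le (l := List.ofFn fun i => X (τ i).castSucc) (by simp),
            List.drop_of_length_le (l := List.ofFn fun i => X (τ i).castSucc) (by simp)]
          have hm' : ¬ n + 1 = p := by omega
          simp [hpn, hm', List.take_append, List.drop_append, h0]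
        · simp [hm, hl]
    simp only [hsplit, Finset.sum_add_distrib]
    congr 1
    · rw [Finset.sum_comm]
      simp only [Finset.sum_ite_eq', Finset.mem_univ, if_true]
      by_cases hpn : p ≤ n
      · simp only [hpn, if_true]
        exact ih hpn _ _
      · simp only [hpn, if_false, Finset.sum_const_zero]
        refine (unshuffleSum_congr fun a b h => ?_).trans (unshuffleSum_zero _)
        simp only [List.length_reverse, List.length_ofFn] at h
        rw [if_neg]
        omega
    · rcases p with _ | p
      · simp [unshuffleSum_zero]
      · have hp' : p ≤ n := by omega
        have hm : ∀ m : Fin (n + 1), m.val + 1 = p + 1 ↔ m = ⟨p, by omega⟩ := by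
          intro m
          rw [Fin.ext_iff]
          simp
        rw [Finset.sum_comm]
        simp only [hm, Finset.sum_ite_eq', Finset.mem_univ, if_true, Nat.add_sub_cancel]
        rw [← ih hp' (fun i => X i.castSucc) fun a b =>
          (-1 : ℤ) ^ (n - p) • F (X (Fin.last n) :: a) b]
        refine unshuffleSum_congr fun a b h => ?_
        simp at h
        by_cases ha : a.length = p
        · have : b.length = n - p := by omega
          simp [ha, this]
        · simp [ha]

/-- Only the summand of the recursion with the last letter in the second subword survives:
`insertLast m τ` fixes the last index exactly when `m` is last. -/
theorem unshuffleSum_eq_sum_perm_fix_last {n p : ℕ} (hp : p ≤ n) (X : Fin (n + 1) → L)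
    (F : List L → List L → A) :
    unshuffleSum (List.ofFn fun i : Fin n => X i.castSucc).reverse
        (fun a b => if a.length = p then F a (X (Fin.last n) :: b) else 0) =
      ∑ σ : Equiv.Perm (Fin (n + 1)), if IncreasingAt p σ ∧ σ (Fin.last n) = Fin.last n then
        (Equiv.Perm.sign σ : ℤ) • F ((List.ofFn fun i => X (σ i)).take p).reverse
          ((List.ofFn fun i => X (σ i)).drop p).reverse else 0 := by
  rw [unshuffleSum_eq_sum_perm hp _ fun a b => F a (X (Fin.last n) :: b),
    ← (insertLast_bijective n).sum_comp, Fintype.sum_prod_type, Finset.sum_comm]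
  refine Finset.sum_congr rfl fun τ _ => ?_
  rw [Finset.sum_eq_single (Fin.last n)]
  · have h0 : p - n = 0 := by omega
    have hm' : ¬ n + 1 = p := by omega
    simp only [increasingAt_insertLast_iff (hp.trans n.le_succ), sign_insertLast,
      ofFn_comp_insertLast, insertLast_self]
    rw [List.take_of_length_le (i := (Fin.last n).val) (by simp),
      List.drop_of_length_le (i := (Fin.last n).val) (by simp)]
    simp [hp, hm', List.take_append, List.drop_append, h0]
  · intro m _ hm
    rw [if_neg]
    rintro ⟨_, h⟩
    apply hm
    apply (insertLast m τ).injective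
    rw [insertLast_self, h]
  · simp

/-- The recursion unrolled: `m` is the letter acted upon, only letters before it can feed `Q`, and
those after it are left alone. -/
theorem insertDer_eq_sum {L E W : Type*} [AddCommGroup L] [Ring E] [AddCommGroup W]
    (s : E →+ AddMonoid.End L) (q : ℕ) (Q : List L → E) {n : ℕ} (X : Fin n → L)
    (Y : List L → W) :
    insertDer s q Q Y (List.ofFn X).reverse =
      ∑ m : Fin n, unshuffleSum ((List.ofFn X).take m.val).reverse fun b a =>
        if b.length = q then
          Y (((List.ofFn X).drop (m.val + 1)).reverse ++ s (Q b) (X m) :: a) else 0 := by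
  induction n generalizing Y with
  | zero => simp [insertDer]
  | succ n ih =>
    have hX : List.ofFn X = (List.ofFn fun i : Fin n => X i.castSucc) ++ [X (Fin.last n)] := by
      rw [List.ofFn_succ', List.concat_eq_append]
    rw [hX, List.reverse_append, List.reverse_singleton, List.singleton_append, insertDer, ih,
      Fin.sum_univ_castSucc]
    congr 1
    · refine Finset.sum_congr rfl fun m _ => ?_
      have h1 : m.val - n = 0 := by omega
      have h2 : m.val + 1 - n = 0 := by omega
      simp [List.take_append, List.drop_append, h1, h2]
    · simp [List.drop_of_length_le]

end PermShuffles

/-! ### Sums over shuffles as sums over splittings of words -/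

section WordSums

variable {L W : Type*} [AddCommGroup W]

theorem IsHomogeneous.ext {p : ℕ} {F G : List L → W}
    (hF : IsHomogeneous p F) (hG : IsHomogeneous p G)
    (h : ∀ X : Fin p → L, F (List.ofFn X).reverse = G (List.ofFn X).reverse)
    (l : List L) : F l = G l := by
  by_cases hl : l.length = p
  · subst hl
    have := h fun i => l.reverse.get (i.cast (by simp))
    have e : (List.ofFn fun i : Fin l.length => l.reverse.get (i.cast (by simp))).reverse = l := by
      rw [List.reverse_eq_iff]
      apply List.ext_getElem
      · simp
      · simp
    rwa [e] at this
  · rw [hF l hl, hG l hl]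

theorem take_ofFn_add (p q : ℕ) (v : Fin (p + q) → L) :
    (List.ofFn v).take p = List.ofFn fun i => v (Fin.castAdd q i) := by
  rw [List.ofFn_add, List.take_append, List.take_of_length_le (by simp)]
  simp
  rfl

theorem drop_ofFn_add (p q : ℕ) (v : Fin (p + q) → L) :
    (List.ofFn v).drop p = List.ofFn fun i => v (Fin.natAdd p i) := by
  rw [List.ofFn_add, List.drop_append, List.drop_of_length_le (by simp)]
  simp

theorem unshuffleSum_eq_sum_shuffles {p q : ℕ} (X : Fin (p + q) → L)
    (F : List L → List L → W) :
    unshuffleSum (List.ofFn X).reverse (fun a b => if a.length = p then F a b else 0) =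
      ∑ σ ∈ shuffles p q, (Equiv.Perm.sign σ : ℤ) •
        F (List.ofFn fun i => X (σ (Fin.castAdd q i))).reverse
          (List.ofFn fun j => X (σ (Fin.natAdd p j))).reverse := by
  rw [unshuffleSum_eq_sum_perm (Nat.le_add_right p q), shuffles, Finset.sum_filter]
  refine Finset.sum_congr rfl fun σ _ => ?_
  simp only [isShuffle_iff]
  congr 3
  · rw [take_ofFn_add]
  · rw [drop_ofFn_add]

theorem unshuffleSum_eq_sum_shufflesFixLast {p q : ℕ}
    (X : Fin (p + (q + 1)) → L) (F : List L → List L → W) :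
    unshuffleSum (List.ofFn fun i : Fin (p + q) => X i.castSucc).reverse
        (fun a b => if a.length = p then F a (X (Fin.last (p + q)) :: b) else 0) =
      ∑ σ ∈ shufflesFixLast p (q + 1), (Equiv.Perm.sign σ : ℤ) •
        F (List.ofFn fun i => X (σ (Fin.castAdd (q + 1) i))).reverse
          (List.ofFn fun j => X (σ (Fin.natAdd p j))).reverse := by
  rw [unshuffleSum_eq_sum_perm_fix_last (Nat.le_add_right p q), shufflesFixLast, shuffles,
    Finset.filter_filter, Finset.sum_filter]
  refine Finset.sum_congr rfl fun σ _ => ?_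
  have hlast : (∀ i : Fin (p + (q + 1)), i.val + 1 = p + (q + 1) → σ i = i) ↔
      σ (Fin.last (p + q)) = Fin.last (p + q) := by
    constructor
    · intro h
      exact h _ (by simp; omega)
    · intro h i hi
      have : i = Fin.last (p + q) := Fin.ext (by simp; omega)
      rw [this, h]
  simp only [isShuffle_iff, hlast]
  congr 3
  · exact congrArg List.reverse (take_ofFn_add p (q + 1) fun i => X (σ i))
  · exact congrArg List.reverse (drop_ofFn_add p (q + 1) fun i => X (σ i))

end WordSums

/-! ### Multilinear maps as functions on words -/

section WordMap

variable {K : Type*} [CommRing K] {L W : Type*} [AddCommGroup L] [Module K L]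
  [AddCommGroup W] [Module K W]

/-- The function on words given by a multilinear map. Words are read from right to left. -/
def wordMap {p : ℕ} (P : MultilinearMap K (fun _ : Fin p => L) W) (l : List L) : W :=
  if l.length = p then P fun i => l.reverse.getD i 0 else 0

theorem wordMap_ofFn {p : ℕ} (P : MultilinearMap K (fun _ : Fin p => L) W) (X : Fin p → L) :
    wordMap P (List.ofFn X).reverse = P X := by
  rw [wordMap, if_pos (by simp)]
  congr 1
  funext i
  simp

theorem isHomogeneous_wordMap {p : ℕ} (P : MultilinearMap K (fun _ : Fin p => L) W) :
    IsHomogeneous p (wordMap P) := fun _ h => if_neg h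

theorem isMultiadditive_wordMap {p : ℕ} (P : MultilinearMap K (fun _ : Fin p => L) W) :
    IsMultiadditive (wordMap P) := by
  intro l₁ l₂ x y
  by_cases h : l₁.length + (l₂.length + 1) = p
  · have hx : ∀ x, wordMap P (l₁ ++ x :: l₂) =
        P (Function.update (fun i : Fin p => (l₁ ++ 0 :: l₂).reverse.getD i 0)
          ⟨l₂.length, by omega⟩ x) := by
      intro x
      rw [wordMap, if_pos (by simpa using h)]
      congr 1
      funext i
      by_cases hi : i = ⟨l₂.length, by omega⟩
      · subst hi
        simp [List.getElem?_append]
      · rw [Function.update_of_ne hi]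
        have hi' : i.val ≠ l₂.length := fun h => hi (Fin.ext h)
        simp only [List.reverse_append, List.reverse_cons, List.append_assoc, List.singleton_append,
          List.getD_eq_getElem?_getD, List.getElem?_append, List.length_reverse]
        split_ifs with h1
        · rfl
        · have : i.val - l₂.length = (i.val - l₂.length - 1) + 1 := by omega
          rw [this]
          rfl
    rw [hx, hx, hx, MultilinearMap.map_update_add]
  · have hx : ∀ x, wordMap P (l₁ ++ x :: l₂) = 0 := fun x => if_neg (by simpa using h)
    rw [hx, hx, hx, add_zero]

/-- The composition carries its signs in `K`, the calculus of words in ℤ. -/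
theorem neg_one_pow_mul_intCast_smul (n : ℕ) (c : ℤ) (w : W) :
    ((-1 : K) ^ n * (c : K)) • w = (-1 : ℤ) ^ n • c • w := by
  rw [mul_smul, Int.cast_smul_eq_zsmul]
  have : (-1 : K) ^ n = (((-1 : ℤ) ^ n : ℤ) : K) := by simp
  rw [this, Int.cast_smul_eq_zsmul]

end WordMap

/-! ### The action on the exterior square and the insertion terms -/

section Derivation

variable {K : Type*} [CommRing K] {g W : Type*} [AddCommGroup g] [Module K g]
  [AddCommGroup W] [Module K W]

/-- The action `f ↦ f ⋆ ·` of endomorphisms on the exterior square. -/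
def wedgeDerHom : Module.End K g →+ AddMonoid.End (⋀[K]^2 g) where
  toFun f := (wedgeDer f).toAddMonoidHom
  map_zero' := by rw [map_zero]; rfl
  map_add' f f' := by rw [map_add]; rfl

theorem wedgeDerHom_apply (f : Module.End K g) (X : ⋀[K]^2 g) :
    wedgeDerHom f X = wedgeDer f X := rfl

theorem wedge_linearMap_ext {f f' : ⋀[K]^2 g →ₗ[K] W}
    (h : ∀ x y, f (wedge K x y) = f' (wedge K x y)) : f = f' := by
  apply exteriorPower.linearMap_ext
  ext v
  have hv : v = ![v 0, v 1] := by
    ext i; fin_cases i <;> rfl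
  have := h (v 0) (v 1)
  rw [wedge, ← hv] at this
  exact this

/-- On x ∧ y the cross terms f x ∧ f' y and f' x ∧ f y occur in both orders of composition and
cancel. -/
theorem wedgeDerHom_commutator (f f' : Module.End K g) (X : ⋀[K]^2 g) :
    wedgeDerHom (f * f' - f' * f) X =
      wedgeDerHom f (wedgeDerHom f' X) - wedgeDerHom f' (wedgeDerHom f X) := by
  simp only [wedgeDerHom_apply]
  have : wedgeDer (f * f' - f' * f) =
      (wedgeDer f) ∘ₗ (wedgeDer f') - (wedgeDer f') ∘ₗ (wedgeDer f) := by
    apply wedge_linearMap_ext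
    intro x y
    have hl : ∀ z w, wedge K (z - w) y = wedge K z y - wedge K w y := fun z w => by
      rw [eq_sub_iff_add_eq, ← wedge_add_left, sub_add_cancel]
    have hr : ∀ z w, wedge K x (z - w) = wedge K x z - wedge K x w := fun z w => by
      rw [eq_sub_iff_add_eq, ← wedge_add_right, sub_add_cancel]
    rw [wedgeDer_wedge]
    simp only [LinearMap.sub_apply, LinearMap.comp_apply, Module.End.mul_apply, wedgeDer_wedge,
      map_add, hl, hr]
    abel
  rw [this]
  rfl

theorem insertDer_wordMap {p q : ℕ} (P : MultilinearMap K (fun _ : Fin p => ⋀[K]^2 g) W)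
    (Q : MultilinearMap K (fun _ : Fin q => ⋀[K]^2 g) (g →ₗ[K] g)) (X : Fin (p + q) → ⋀[K]^2 g) :
    insertDer (E := Module.End K g) wedgeDerHom q (wordMap Q) (wordMap P) (List.ofFn X).reverse =
      ∑ k : Fin p, ∑ σ ∈ shuffles k q, ((-1 : K) ^ (k.val * q) * (Equiv.Perm.sign σ : ℤ)) •
        P (Function.update (fun i => X (slotIdx q k σ i)) k
          (wedgeDer (Q fun j => X (firstIdx q k (σ (Fin.natAdd k j))))
            (X ⟨k + q, by omega⟩))) := by
  rw [insertDer_eq_sum]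
  -- A letter with fewer than `q` predecessors leaves no room for the arguments of `Q`. The other
  -- letters are those at m = k + q with k < p, whence the reindexing by `e`.
  have hzero : ∀ m : Fin (p + q), m.val < q →
      (unshuffleSum ((List.ofFn X).take m.val).reverse fun b a =>
        if b.length = q then wordMap P (((List.ofFn X).drop (m.val + 1)).reverse ++
          wedgeDerHom (wordMap Q b : Module.End K g) (X m) :: a) else 0) = 0 := by
    intro m hm
    refine (unshuffleSum_congr fun b a h => ?_).trans (unshuffleSum_zero _)
    simp at h
    rw [if_neg]
    omega
  let e : Fin q ⊕ Fin p ≃ Fin (p + q) := finSumFinEquiv.trans (finCongr (add_comm q p))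
  rw [← e.sum_comp, Fintype.sum_sum_type, Finset.sum_eq_zero, zero_add]
  swap
  · intro i _
    exact hzero _ (by simp [e])
  refine Finset.sum_congr rfl fun k _ => ?_
  have hk : (e (Sum.inr k)) = ⟨k + q, by omega⟩ := by
    apply Fin.ext
    simp [e, add_comm]
  rw [hk]
  have htake : (List.ofFn X).take (k.val + q) =
      List.ofFn fun i : Fin (k.val + q) => X (firstIdx q k i) := by
    apply List.ext_getElem
    · simp
    · intro i h1 h2
      simp
      rfl
  dsimp only
  -- `insertDer` lists the arguments of `Q` first, whereas the composition lists the k remaining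
  -- ones first; exchanging them produces the factor (-1)^{kq}.
  rw [htake, unshuffleSum_swap]
  have hsw : (unshuffleSum (List.ofFn fun i : Fin (k.val + q) => X (firstIdx q k i)).reverse
      fun a b => (-1 : ℤ) ^ (a.length * b.length) • if b.length = q then
        wordMap P (((List.ofFn X).drop (k.val + q + 1)).reverse ++
          wedgeDerHom (wordMap Q b : Module.End K g) (X ⟨k + q, by omega⟩) :: a) else 0) =
      unshuffleSum (List.ofFn fun i : Fin (k.val + q) => X (firstIdx q k i)).reverse
      fun a b => if a.length = k.val then (-1 : ℤ) ^ (k.val * q) •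
        wordMap P (((List.ofFn X).drop (k.val + q + 1)).reverse ++
          wedgeDerHom (wordMap Q b : Module.End K g) (X ⟨k + q, by omega⟩) :: a) else 0 := by
    refine unshuffleSum_congr fun a b h => ?_
    simp only [List.length_reverse, List.length_ofFn] at h
    by_cases ha : a.length = k.val
    · have hb : b.length = q := by omega
      rw [if_pos ha, if_pos hb, ha, hb]
    · rw [if_neg ha, if_neg (by omega), smul_zero]
  rw [hsw, unshuffleSum_eq_sum_shuffles]
  refine Finset.sum_congr rfl fun σ _ => ?_
  rw [neg_one_pow_mul_intCast_smul, smul_comm, wordMap_ofFn, wedgeDerHom_apply, ← wordMap_ofFn P]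
  congr 4
  rw [← List.reverse_inj]
  simp only [List.reverse_append, List.reverse_cons, List.reverse_reverse, List.append_assoc,
    List.singleton_append]
  apply List.ext_getElem
  · simp; omega
  · intro i h1 h2
    simp only [List.length_ofFn] at h2
    rw [List.getElem_ofFn]
    rcases lt_trichotomy i k.val with hi | hi | hi
    · rw [List.getElem_append_left (by simpa using hi), Function.update_of_ne]
      · rw [List.getElem_ofFn, slotIdx, dif_pos hi]
      · exact fun h => hi.ne (congrArg Fin.val h)
    · subst hi
      rw [List.getElem_append_right (by simp)]
      simp
    · obtain ⟨j, rfl⟩ : ∃ j, i = k.val + (j + 1) := ⟨i - k.val - 1, by omega⟩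
      rw [List.getElem_append_right (by simp), Function.update_of_ne]
      · simp only [List.length_ofFn, Nat.add_sub_cancel_left, List.getElem_cons_succ, List.getElem_drop,
          List.getElem_ofFn]
        rw [slotIdx, dif_neg (fun h : k.val + (j + 1) < k.val => by omega)]
        congr 1
        apply Fin.ext
        change k.val + q + 1 + j = k.val + (j + 1) + q
        omega
      · exact fun h => hi.ne' (congrArg Fin.val h)

end Derivation

/-! ### The graded Jacobi identity on words -/

section WordJacobi

variable {L E W : Type*} [AddCommGroup L] [Ring E] [AddCommGroup W] [Module E W]
  (s : E →+ AddMonoid.End L)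

theorem wordAct_zsmul (c : ℤ) (p : ℕ) (P : List L → E) (Y : List L → W) (l : List L) :
    wordAct s p P (fun l => c • Y l) l = c • wordAct s p P Y l := by
  simp only [wordAct, insertDer_zsmul, shuffleMul, smul_comm _ c, unshuffleSum_zsmul, smul_sub]

theorem halfWordAct_sub (p : ℕ) (P : List L → E) (Y Z : List L → W) (l : List L) :
    halfWordAct s p P (fun l => Y l - Z l) l = halfWordAct s p P Y l - halfWordAct s p P Z l := by
  rcases l with _ | ⟨X, l⟩
  · simp [halfWordAct, halfShuffleMul, insertDer]
  · simp only [halfWordAct, insertDer_sub, halfShuffleMul, shuffleMul, smul_sub, unshuffleSum_sub]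
    abel

theorem halfWordAct_zsmul (c : ℤ) (p : ℕ) (P : List L → E) (Y : List L → W) (l : List L) :
    halfWordAct s p P (fun l => c • Y l) l = c • halfWordAct s p P Y l := by
  rcases l with _ | ⟨X, l⟩
  · simp [halfWordAct, halfShuffleMul, insertDer]
  · simp only [halfWordAct, insertDer_zsmul, halfShuffleMul, shuffleMul, smul_comm _ c,
      unshuffleSum_zsmul, smul_sub]

/-- The first component of the graded commutator of the pairs `(P', P)` and `(Q', Q)`. -/
def halfWordBracket (p q : ℕ) (P Q : List L → E) (P' Q' : List L → W) (l : List L) : W :=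
  halfWordAct s p P Q' l - (-1 : ℤ) ^ (p * q) • halfWordAct s q Q P' l

/-- The commutator of a graded left-symmetric product satisfies the graded Jacobi identity: once
each action of a bracket is expanded by `wordAct_bracket`, the double products cancel in pairs. -/
theorem wordBracket_jacobi
    (hs : ∀ f g x, s (f * g - g * f) x = s f (s g x) - s g (s f x)) {p q r : ℕ}
    {P Q R : List L → E} (hP : IsHomogeneous p P) (hQ : IsHomogeneous q Q)
    (hR : IsHomogeneous r R)
    (hP' : IsMultiadditive P) (hQ' : IsMultiadditive Q)
    (hR' : IsMultiadditive R) (l : List L) :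
    wordBracket s p (q + r) P (wordBracket s q r Q R) l =
      wordBracket s (p + q) r (wordBracket s p q P Q) R l +
        (-1 : ℤ) ^ (p * q) • wordBracket s q (p + r) Q (wordBracket s p r P R) l := by
  have hB : ∀ q r (Q R : List L → E), wordBracket s q r Q R =
      fun l => wordAct s q Q R l - (-1 : ℤ) ^ (q * r) • wordAct s r R Q l := fun _ _ _ _ => rfl
  have h : ∀ p q r, ∀ P Q R : List L → E, wordAct s p P (wordBracket s q r Q R) l =
      wordAct s p P (wordAct s q Q R) l -
        (-1 : ℤ) ^ (q * r) • wordAct s p P (wordAct s r R Q) l := by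
    intro p q r P Q R
    rw [hB, wordAct_sub, wordAct_zsmul]
  rw [wordBracket, wordBracket, wordBracket, h, h, h, wordAct_bracket s hs hQ hR hP',
    wordAct_bracket s hs hP hQ hR', wordAct_bracket s hs hP hR hQ']
  simp only [mul_add, add_mul, pow_add, mul_comm q p]
  -- All signs are products of the three signs with exponents pq, qr and pr, so eight cases remain.
  rcases neg_one_pow_eq_or ℤ (p * q) with h1 | h1 <;>
  rcases neg_one_pow_eq_or ℤ (q * r) with h2 | h2 <;>
  rcases neg_one_pow_eq_or ℤ (p * r) with h3 | h3 <;>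
  · rw [h1, h2, h3]
    simp
    abel

/-- The Jacobi identity of a semidirect product: it needs only that `halfWordAct` is a
representation. -/
theorem halfWordBracket_jacobi
    (hs : ∀ f g x, s (f * g - g * f) x = s f (s g x) - s g (s f x)) {p q r : ℕ}
    {P Q R : List L → E} (hP : IsHomogeneous p P) (hQ : IsHomogeneous q Q)
    (hR : IsHomogeneous r R)
    {P' Q' R' : List L → W} (hP' : IsMultiadditive P')
    (hQ' : IsMultiadditive Q') (hR' : IsMultiadditive R') (l : List L) :
    halfWordBracket s p (q + r) P (wordBracket s q r Q R) P' (halfWordBracket s q r Q R Q' R') l =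
      halfWordBracket s (p + q) r (wordBracket s p q P Q) R
          (halfWordBracket s p q P Q P' Q') R' l +
        (-1 : ℤ) ^ (p * q) • halfWordBracket s q (p + r) Q (wordBracket s p r P R) Q'
          (halfWordBracket s p r P R P' R') l := by
  have hB : ∀ q r (Q R : List L → E) (Q' R' : List L → W), halfWordBracket s q r Q R Q' R' =
      fun l => halfWordAct s q Q R' l - (-1 : ℤ) ^ (q * r) • halfWordAct s r R Q' l :=
    fun _ _ _ _ _ _ => rfl
  have h : ∀ p q r, ∀ P Q R : List L → E, ∀ Q' R' : List L → W,
      halfWordAct s p P (halfWordBracket s q r Q R Q' R') l =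
      halfWordAct s p P (halfWordAct s q Q R') l -
        (-1 : ℤ) ^ (q * r) • halfWordAct s p P (halfWordAct s r R Q') l := by
    intro p q r P Q R Q' R'
    rw [hB, halfWordAct_sub, halfWordAct_zsmul]
  rw [halfWordBracket, halfWordBracket, halfWordBracket, h, h, h,
    halfWordAct_bracket s hs hQ hR hP', halfWordAct_bracket s hs hP hQ hR',
    halfWordAct_bracket s hs hP hR hQ']
  simp only [mul_add, add_mul, pow_add, mul_comm q p]
  rcases neg_one_pow_eq_or ℤ (p * q) with h1 | h1 <;>
  rcases neg_one_pow_eq_or ℤ (q * r) with h2 | h2 <;>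
  rcases neg_one_pow_eq_or ℤ (p * r) with h3 | h3 <;>
  · rw [h1, h2, h3]
    simp
    abel

end WordJacobi

/-! ### The graded Lie algebra of cochains -/

section CochainWords

variable {K : Type*} [CommRing K] {g : Type*} [AddCommGroup g] [Module K g]

/-- The first component of a cochain, as a function on words. -/
def Cochain.wordI {p : ℕ} (P : Cochain K g p) : List (⋀[K]^2 g) → g := wordMap P.I

/-- The second component of a cochain, as a function on words. -/
def Cochain.wordII {p : ℕ} (P : Cochain K g p) : List (⋀[K]^2 g) → Module.End K g := wordMap P.II

theorem wordII_comp {p q : ℕ} (P : Cochain K g p) (Q : Cochain K g q) (l : List (⋀[K]^2 g)) :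
    (comp P Q).wordII l = (-1 : ℤ) ^ (p * q) • shuffleMul P.wordII Q.wordII l +
      insertDer (wedgeDerHom (K := K) (g := g)) q Q.wordII P.wordII l := by
  have hP : IsHomogeneous p P.wordII := isHomogeneous_wordMap _
  have hQ : IsHomogeneous q Q.wordII := isHomogeneous_wordMap _
  refine IsHomogeneous.ext (p := p + q) (F := (comp P Q).wordII)
    (G := fun l => (-1 : ℤ) ^ (p * q) • shuffleMul P.wordII Q.wordII l +
      insertDer (wedgeDerHom (K := K) (g := g)) q Q.wordII P.wordII l)
    (isHomogeneous_wordMap _) ?_ ?_ l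
  · intro l hl
    dsimp only
    rw [isHomogeneous_shuffleMul hP hQ l hl,
      isHomogeneous_insertDer _ _ hP l (by omega), smul_zero, add_zero]
  · intro X
    change wordMap (compII P Q) _ = _
    rw [wordMap_ofFn]
    have h1 : shuffleMul P.wordII Q.wordII (List.ofFn X).reverse =
        ∑ σ ∈ shuffles p q, (Equiv.Perm.sign σ : ℤ) •
          ((P.II (fun i => X (σ (Fin.castAdd q i))) : Module.End K g) *
            Q.II fun j => X (σ (Fin.natAdd p j))) := by
      have h := unshuffleSum_eq_sum_shuffles X fun a b => P.wordII a • Q.wordII b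
      simp only [Cochain.wordII, wordMap_ofFn] at h
      refine Eq.trans (unshuffleSum_congr fun a b _ => ?_) h
      split_ifs with ha
      · rfl
      · rw [hP a ha, zero_smul]
    have h2 := insertDer_wordMap P.II Q.II X
    apply LinearMap.ext
    intro x
    rw [compII_apply]
    change _ = ((-1 : ℤ) ^ (p * q) • shuffleMul P.wordII Q.wordII (List.ofFn X).reverse) x +
      insertDer (E := Module.End K g) wedgeDerHom q (wordMap Q.II) (wordMap P.II)
        (List.ofFn X).reverse x
    rw [h1, h2]
    congr 1
    · rw [Finset.smul_sum, LinearMap.sum_apply]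
      refine Finset.sum_congr rfl fun σ _ => ?_
      rw [neg_one_pow_mul_intCast_smul]
      rfl
    · rw [LinearMap.sum_apply]
      refine Finset.sum_congr rfl fun k _ => ?_
      rw [LinearMap.sum_apply]
      rfl

theorem wordI_comp {p q : ℕ} (P : Cochain K g p) (Q : Cochain K g q) (l : List (⋀[K]^2 g)) :
    (comp P Q).wordI l = (-1 : ℤ) ^ (p * q) • halfShuffleMul P.wordII Q.wordI l +
      insertDer (wedgeDerHom (K := K) (g := g)) q Q.wordII P.wordI l := by
  have hP : IsHomogeneous p P.wordII := isHomogeneous_wordMap _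
  have hPI : IsHomogeneous p P.wordI := isHomogeneous_wordMap _
  have hQI : IsHomogeneous q Q.wordI := isHomogeneous_wordMap _
  have hhalf : IsHomogeneous (p + q) (halfShuffleMul P.wordII Q.wordI) := by
    intro l hl
    rcases l with _ | ⟨X, l⟩
    · rfl
    · refine (unshuffleSum_congr fun a b h => ?_).trans (unshuffleSum_zero _)
      by_cases ha : a.length = p
      · change P.wordII a • Q.wordI (X :: b) = 0
        rw [hQI, smul_zero]
        simp at hl ⊢
        omega
      · rw [hP a ha, zero_smul]
  refine IsHomogeneous.ext (p := p + q) (F := (comp P Q).wordI)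
    (G := fun l => (-1 : ℤ) ^ (p * q) • halfShuffleMul P.wordII Q.wordI l +
      insertDer (wedgeDerHom (K := K) (g := g)) q Q.wordII P.wordI l)
    (isHomogeneous_wordMap _) ?_ ?_ l
  · intro l hl
    dsimp only
    rw [hhalf l hl, isHomogeneous_insertDer _ _ hPI l (by omega), smul_zero, add_zero]
  · intro X
    change wordMap (compI P Q) _ = _
    rw [wordMap_ofFn, compI_apply]
    have h1 : halfShuffleMul P.wordII Q.wordI (List.ofFn X).reverse =
        ∑ σ ∈ shufflesFixLast p q, (Equiv.Perm.sign σ : ℤ) •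
          P.II (fun i => X (σ (Fin.castAdd q i))) (Q.I fun j => X (σ (Fin.natAdd p j))) := by
      -- For q = 0 there is no last argument of `Q.I` to receive the last letter, but `Q.I` vanishes
      -- by definition of the cochains of degree 0, and so do both sides.
      rcases q with _ | q
      · have h0 : Q.I = 0 := Q.2 rfl
        have h0' : Q.wordI = fun _ => 0 := by
          funext l
          simp [Cochain.wordI, wordMap, h0]
        rw [h0, h0']
        simp only [_root_.zero_apply, map_zero, smul_zero, Finset.sum_const_zero]
        generalize (List.ofFn X).reverse = l
        rcases l with _ | ⟨Y, l⟩
        · rfl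
        · simp [halfShuffleMul, shuffleMul, unshuffleSum_zero]
      · have h := unshuffleSum_eq_sum_shufflesFixLast X fun a b => P.wordII a • Q.wordI b
        simp only [Cochain.wordII, Cochain.wordI, wordMap_ofFn] at h
        have hrev : (List.ofFn X).reverse = X (Fin.last (p + q)) ::
            (List.ofFn fun i : Fin (p + q) => X i.castSucc).reverse := by
          have : List.ofFn X = _ := List.ofFn_succ' (n := p + q) X
          rw [this, List.concat_eq_append, List.reverse_append]
          rfl
        rw [hrev]
        refine Eq.trans (unshuffleSum_congr fun a b _ => ?_) h
        split_ifs with ha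
        · rfl
        · rw [hP a ha, zero_smul]
    have h2 := insertDer_wordMap P.I Q.II X
    rw [h1]
    change _ = _ + insertDer (E := Module.End K g) wedgeDerHom q (wordMap Q.II) (wordMap P.I)
        (List.ofFn X).reverse
    rw [h2]
    congr 1
    rw [Finset.smul_sum]
    refine Finset.sum_congr rfl fun σ _ => ?_
    rw [neg_one_pow_mul_intCast_smul]

variable (K g)

/-- The pair of functions on words given by an element of the direct sum of all cochains. -/
def cochainWords :
    (⨁ p, Cochain K g p) →ₗ[K] (List (⋀[K]^2 g) → g) × (List (⋀[K]^2 g) → Module.End K g) :=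
  DirectSum.toModule K ℕ _ fun p =>
    { toFun := fun P => (P.wordI, P.wordII)
      map_add' := by
        intro P Q
        have h1 : (P + Q).I = P.I + Q.I := rfl
        have h2 : (P + Q).II = P.II + Q.II := rfl
        refine Prod.ext (funext fun l => ?_) (funext fun l => ?_)
        · change wordMap (P + Q).I l = wordMap P.I l + wordMap Q.I l
          rw [h1]
          unfold wordMap
          split_ifs <;> simp
        · change wordMap (P + Q).II l = wordMap P.II l + wordMap Q.II l
          rw [h2]
          unfold wordMap
          split_ifs <;> simp
      map_smul' := by
        intro c P
        have h1 : (c • P).I = c • P.I := rfl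
        have h2 : (c • P).II = c • P.II := rfl
        refine Prod.ext (funext fun l => ?_) (funext fun l => ?_)
        · change wordMap (c • P).I l = c • wordMap P.I l
          rw [h1]
          unfold wordMap
          split_ifs <;> simp
        · change wordMap (c • P).II l = c • wordMap P.II l
          rw [h2]
          unfold wordMap
          split_ifs <;> simp }

theorem cochainWords_lof {p : ℕ} (P : Cochain K g p) :
    cochainWords K g (DirectSum.lof K ℕ (fun n => Cochain K g n) p P) = (P.wordI, P.wordII) := by
  rw [cochainWords, DirectSum.toModule_lof]
  rfl

theorem cochainWords_apply_ofFn (x : ⨁ p, Cochain K g p) {p : ℕ} (X : Fin p → ⋀[K]^2 g) :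
    (cochainWords K g x).1 (List.ofFn X).reverse = (x p).I X ∧
      (cochainWords K g x).2 (List.ofFn X).reverse = (x p).II X := by
  induction x using DirectSum.induction_on with
  | zero =>
    rw [map_zero]
    exact ⟨rfl, rfl⟩
  | of q Q =>
    have h := cochainWords_lof K g Q
    rw [DirectSum.lof_eq_of] at h
    rw [h]
    by_cases hpq : q = p
    · subst hpq
      rw [DirectSum.of_eq_same]
      exact ⟨wordMap_ofFn _ _, wordMap_ofFn _ _⟩
    · rw [DirectSum.of_eq_of_ne _ _ _ (Ne.symm hpq)]
      exact ⟨isHomogeneous_wordMap _ _ (by simpa using Ne.symm hpq),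
        isHomogeneous_wordMap _ _ (by simpa using Ne.symm hpq)⟩
  | add x y hx hy =>
    rw [map_add, Prod.fst_add, Prod.snd_add, Pi.add_apply, Pi.add_apply, hx.1, hx.2, hy.1, hy.2]
    exact ⟨rfl, rfl⟩

/-- The words of length p see exactly the component of degree p. Identities between elements given
in degrees such as p + (q + r) and p + q + r can thus be checked on words, where the degree is not
part of the type. -/
theorem cochainWords_injective : Function.Injective (cochainWords K g) := by
  intro x y h
  refine DFinsupp.ext fun p => Cochain.ext (MultilinearMap.ext fun X => ?_)
    (MultilinearMap.ext fun X => ?_)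
  · rw [← (cochainWords_apply_ofFn K g x X).1, h, (cochainWords_apply_ofFn K g y X).1]
  · rw [← (cochainWords_apply_ofFn K g x X).2, h, (cochainWords_apply_ofFn K g y X).2]

variable {K g}

/-- Extracting the sign (-1)^{pq} removes the sign from the shuffle product P * Q and turns the
bracket into commutators of `halfWordAct` and `wordAct`. -/
theorem exists_lieYBracket_lof {p q : ℕ} (P : Cochain K g p) (Q : Cochain K g q) :
    ∃ Z : Cochain K g (p + q),
      lieYBracket K g (DirectSum.lof K ℕ (fun n => Cochain K g n) p P)
        (DirectSum.lof K ℕ (fun n => Cochain K g n) q Q) =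
          (-1 : K) ^ (p * q) • DirectSum.lof K ℕ (fun n => Cochain K g n) (p + q) Z ∧
      Z.wordI = halfWordBracket wedgeDerHom p q P.wordII Q.wordII P.wordI Q.wordI ∧
      Z.wordII = wordBracket wedgeDerHom p q P.wordII Q.wordII := by
  -- Q ∘ P has degree q + p; inside the direct sum it equals an element of degree p + q.
  have hcast : ∀ m n, m = n → ∀ Y : Cochain K g m, ∃ Y' : Cochain K g n,
      DirectSum.lof K ℕ (fun n => Cochain K g n) m Y =
        DirectSum.lof K ℕ (fun n => Cochain K g n) n Y' := by
    rintro m _ rfl Y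
    exact ⟨Y, rfl⟩
  obtain ⟨Y, hY⟩ := hcast _ _ (add_comm q p) (comp Q P)
  have hK : (-1 : K) ^ (p * q) * (-1 : K) ^ (p * q) = 1 := by
    rw [← mul_pow]
    simp
  have hz : ∀ {V : Type _} [AddCommGroup V] [Module K V] (v : V),
      (-1 : K) ^ (p * q) • v = (-1 : ℤ) ^ (p * q) • v := by
    intro V _ _ v
    rcases neg_one_pow_eq_or ℤ (p * q) with h | h
    all_goals
      have h' := congrArg (Int.cast : ℤ → K) h
      push_cast at h'
      rw [h, h']
      simp
  have hw := congrArg (cochainWords K g) hY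
  rw [cochainWords_lof, cochainWords_lof, Prod.ext_iff] at hw
  obtain ⟨hI, hII⟩ := hw
  dsimp only at hI hII
  refine ⟨(-1 : K) ^ (p * q) • comp P Q - Y, ?_, ?_⟩
  · rw [lieYBracket_lof, hY, map_sub, map_smul, smul_sub, ← mul_smul, hK, one_smul]
  · have hw := cochainWords_lof K g ((-1 : K) ^ (p * q) • comp P Q - Y)
    rw [map_sub, map_sub, map_smul, map_smul, cochainWords_lof, cochainWords_lof, ← hI, ← hII,
      Prod.ext_iff] at hw
    have e : (-1 : ℤ) ^ (p * q) * (-1 : ℤ) ^ (p * q) = 1 := by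
      rw [← mul_pow]
      simp
    refine ⟨hw.1.symm.trans (funext fun l => ?_), hw.2.symm.trans (funext fun l => ?_)⟩
    · change (-1 : K) ^ (p * q) • (comp P Q).wordI l - (comp Q P).wordI l = _
      rw [hz, wordI_comp, wordI_comp, halfWordBracket, halfWordAct, halfWordAct, mul_comm q p]
      simp only [smul_add, smul_sub, ← mul_smul, e, one_smul]
      abel
    · change (-1 : K) ^ (p * q) • (comp P Q).wordII l - (comp Q P).wordII l = _
      rw [hz, wordII_comp, wordII_comp, wordBracket, wordAct, wordAct, mul_comm q p]
      simp only [smul_add, smul_sub, ← mul_smul, e, one_smul]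
      abel

theorem isGradedLieBracket_lieYBracket :
    IsGradedLieBracket K (fun p => Cochain K g p) (lieYBracket K g) where
  degree p q P Q := by
    obtain ⟨Z, hZ, -⟩ := exists_lieYBracket_lof P Q
    exact ⟨(-1 : K) ^ (p * q) • Z, by rw [hZ, map_smul]⟩
  skew p q P Q := by
    have hK : (-1 : K) ^ (p * q) * (-1 : K) ^ (p * q) = 1 := by
      rw [← mul_pow]
      simp
    rw [lieYBracket_lof, lieYBracket_lof, mul_comm q p, smul_sub, ← mul_smul, hK, one_smul,
      neg_sub]
  jacobi p q r P Q R := by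
    obtain ⟨A, hA, hA1, hA2⟩ := exists_lieYBracket_lof Q R
    obtain ⟨A', hA', hA1', hA2'⟩ := exists_lieYBracket_lof P A
    obtain ⟨B, hB, hB1, hB2⟩ := exists_lieYBracket_lof P Q
    obtain ⟨B', hB', hB1', hB2'⟩ := exists_lieYBracket_lof B R
    obtain ⟨C, hC, hC1, hC2⟩ := exists_lieYBracket_lof P R
    obtain ⟨C', hC', hC1', hC2'⟩ := exists_lieYBracket_lof Q C
    rw [hA, hB, hC, map_smul, map_smul, map_smul, LinearMap.smul_apply, hA', hB', hC']
    have key : DirectSum.lof K ℕ (fun n => Cochain K g n) (p + (q + r)) A' =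
        DirectSum.lof K ℕ (fun n => Cochain K g n) (p + q + r) B' +
          (-1 : ℤ) ^ (p * q) • DirectSum.lof K ℕ (fun n => Cochain K g n) (q + (p + r)) C' := by
      apply cochainWords_injective
      rw [map_add, map_zsmul, cochainWords_lof, cochainWords_lof, cochainWords_lof, hA1', hA2',
        hB1', hB2', hC1', hC2', hA1, hA2, hB1, hB2, hC1, hC2]
      have hP : IsHomogeneous p P.wordII := isHomogeneous_wordMap _
      have hQ : IsHomogeneous q Q.wordII := isHomogeneous_wordMap _
      have hR : IsHomogeneous r R.wordII := isHomogeneous_wordMap _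
      refine Prod.ext (funext fun l => ?_) (funext fun l => ?_)
      · exact halfWordBracket_jacobi _ wedgeDerHom_commutator hP hQ hR
          (isMultiadditive_wordMap _) (isMultiadditive_wordMap _) (isMultiadditive_wordMap _) l
      · exact wordBracket_jacobi _ wedgeDerHom_commutator hP hQ hR
          (isMultiadditive_wordMap _) (isMultiadditive_wordMap _) (isMultiadditive_wordMap _) l
    have hz : (-1 : ℤ) ^ (p * q) • DirectSum.lof K ℕ (fun n => Cochain K g n) (q + (p + r)) C' =
        (-1 : K) ^ (p * q) •
          DirectSum.lof K ℕ (fun n => Cochain K g n) (q + (p + r)) C' := by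
      rw [← Int.cast_smul_eq_zsmul K]
      simp
    rw [key, hz]
    -- Each double bracket carries the same normalizing sign (-1)^{pq + qr + pr}, so the identity on
    -- words gives the one for the bracket.
    simp only [smul_add, ← mul_smul, ← pow_add]
    congr 2 <;> congr 1 <;> ring

end CochainWords

/-! ### Maurer-Cartan elements -/

section MaurerCartan

variable {K : Type*} [CommRing K] {g : Type*} [AddCommGroup g] [Module K g]

/-- The linear map on the exterior square given by the first component of a `1`-cochain. -/
def Cochain.binLin (Φ : Cochain K g 1) : ⋀[K]^2 g →ₗ[K] g := Φ.I.toLinearMap (fun _ => 0) 0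

/-- The linear map on the exterior square given by the second component of a `1`-cochain. -/
def Cochain.triLin (Φ : Cochain K g 1) : ⋀[K]^2 g →ₗ[K] g →ₗ[K] g :=
  Φ.II.toLinearMap (fun _ => 0) 0

theorem binLin_wedge (Φ : Cochain K g 1) (x y : g) : Φ.binLin (wedge K x y) = Φ.bin x y := by
  change Φ.I _ = Φ.I _
  congr 1
  funext i
  rw [Subsingleton.elim i 0, Function.update_self]

theorem triLin_wedge (Φ : Cochain K g 1) (x y z : g) :
    Φ.triLin (wedge K x y) z = Φ.tri x y z := by
  change Φ.II _ z = Φ.II _ z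
  congr 2
  funext i
  rw [Subsingleton.elim i 0, Function.update_self]

theorem wordI_singleton (Φ : Cochain K g 1) (X : ⋀[K]^2 g) : Φ.wordI [X] = Φ.binLin X := by
  refine (wordMap_ofFn Φ.I fun _ => X).trans ?_
  change Φ.I _ = Φ.I _
  congr 1
  funext i
  rw [Subsingleton.elim i 0, Function.update_self]

theorem wordII_singleton (Φ : Cochain K g 1) (X : ⋀[K]^2 g) : Φ.wordII [X] = Φ.triLin X := by
  refine (wordMap_ofFn Φ.II fun _ => X).trans ?_
  change Φ.II _ = Φ.II _
  congr 1
  funext i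
  rw [Subsingleton.elim i 0, Function.update_self]

/-- On a word of two letters, X 1 is last: the half-shuffle product leaves one splitting and X 1 is
the only letter with a predecessor to insert. -/
theorem comp_I_apply_one (Φ : Cochain K g 1) (X : Fin 2 → ⋀[K]^2 g) :
    (comp Φ Φ).I X = Φ.binLin (wedgeDer (Φ.triLin (X 0)) (X 1)) -
      Φ.triLin (X 0) (Φ.binLin (X 1)) := by
  have h := wordI_comp Φ Φ (List.ofFn X).reverse
  have h0 : Φ.wordII [] = 0 := isHomogeneous_wordMap _ _ (by simp)
  rw [Cochain.wordI, wordMap_ofFn] at h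
  rw [h]
  simp only [List.ofFn_succ, List.ofFn_zero]
  simp [halfShuffleMul, shuffleMul, insertDer, unshuffleSum, h0, wordI_singleton,
    wordII_singleton, wedgeDerHom_apply]
  abel

theorem comp_II_apply_one (Φ : Cochain K g 1) (X : Fin 2 → ⋀[K]^2 g) (t : g) :
    (comp Φ Φ).II X t = Φ.triLin (wedgeDer (Φ.triLin (X 0)) (X 1)) t +
      Φ.triLin (X 1) (Φ.triLin (X 0) t) - Φ.triLin (X 0) (Φ.triLin (X 1) t) := by
  have h := wordII_comp Φ Φ (List.ofFn X).reverse
  have h0 : Φ.wordII [] = 0 := isHomogeneous_wordMap _ _ (by simp)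
  rw [Cochain.wordII, wordMap_ofFn] at h
  rw [h]
  simp only [List.ofFn_succ, List.ofFn_zero]
  simp [shuffleMul, insertDer, unshuffleSum, h0, wordII_singleton, wedgeDerHom_apply]
  abel

theorem comp_self_eq_zero_iff (Φ : Cochain K g 1) :
    comp Φ Φ = 0 ↔
      (∀ x y z w : g,
        Φ.tri x y (Φ.bin z w) = Φ.bin (Φ.tri x y z) w + Φ.bin z (Φ.tri x y w)) ∧
      (∀ x y z w t : g,
        Φ.tri x y (Φ.tri z w t) =
          Φ.tri (Φ.tri x y z) w t + Φ.tri z (Φ.tri x y w) t + Φ.tri z w (Φ.tri x y t)) := by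
  -- Identities (c) and (d) for arbitrary elements X, Y of the exterior square: ω(X, ·) is a
  -- derivation of π and of ω.
  have h1 : comp Φ Φ = 0 ↔
      (∀ X Y, Φ.triLin X (Φ.binLin Y) = Φ.binLin (wedgeDer (Φ.triLin X) Y)) ∧
      (∀ X Y t, Φ.triLin X (Φ.triLin Y t) =
        Φ.triLin (wedgeDer (Φ.triLin X) Y) t + Φ.triLin Y (Φ.triLin X t)) := by
    constructor
    · intro h
      have hI : ∀ X, (comp Φ Φ).I X = 0 := fun X => by rw [h]; rfl
      have hII : ∀ X t, (comp Φ Φ).II X t = 0 := fun X t => by rw [h]; rfl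
      refine ⟨fun X Y => ?_, fun X Y t => ?_⟩
      · have := hI ![X, Y]
        rw [comp_I_apply_one] at this
        exact (sub_eq_zero.1 this).symm
      · have := hII ![X, Y] t
        rw [comp_II_apply_one] at this
        exact (sub_eq_zero.1 this).symm
    · rintro ⟨hI, hII⟩
      apply Cochain.ext
      · refine MultilinearMap.ext fun X => ?_
        rw [comp_I_apply_one, hI, sub_self]
        rfl
      · refine MultilinearMap.ext fun X => LinearMap.ext fun t => ?_
        rw [comp_II_apply_one, hII (X 0), sub_self]
        rfl
  rw [h1]
  refine and_congr ⟨fun h x y z w => ?_, fun h => ?_⟩ ⟨fun h x y z w t => ?_, fun h => ?_⟩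
  · have := h (wedge K x y) (wedge K z w)
    rw [wedgeDer_wedge, map_add] at this
    simp only [binLin_wedge, triLin_wedge] at this
    rw [this, add_comm]
  · intro X Y
    -- Both sides are linear in X for fixed Y and in Y for fixed X, so agreement on decomposable
    -- elements propagates first to all Y, then to all X.
    have e : Φ.triLin.flip (Φ.binLin Y) = Φ.binLin ∘ₗ wedgeDer.flip Y ∘ₗ Φ.triLin := by
      refine wedge_linearMap_ext fun x y => ?_
      have e' : Φ.triLin (wedge K x y) ∘ₗ Φ.binLin =
          Φ.binLin ∘ₗ wedgeDer (Φ.triLin (wedge K x y)) := by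
        refine wedge_linearMap_ext fun z w => ?_
        simp only [LinearMap.comp_apply, wedgeDer_wedge, map_add, binLin_wedge, triLin_wedge, h]
        rw [add_comm]
      exact LinearMap.congr_fun e' Y
    exact LinearMap.congr_fun e X
  · have := h (wedge K x y) (wedge K z w) t
    rw [wedgeDer_wedge, map_add, LinearMap.add_apply] at this
    simp only [triLin_wedge] at this
    rw [this]
    abel
  · intro X Y t
    have e : Φ.triLin.flip (Φ.triLin Y t) =
        Φ.triLin.flip t ∘ₗ wedgeDer.flip Y ∘ₗ Φ.triLin + Φ.triLin Y ∘ₗ Φ.triLin.flip t := by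
      refine wedge_linearMap_ext fun x y => ?_
      have e' : Φ.triLin (wedge K x y) ∘ₗ Φ.triLin.flip t =
          Φ.triLin.flip t ∘ₗ wedgeDer (Φ.triLin (wedge K x y)) +
            Φ.triLin.flip (Φ.triLin (wedge K x y) t) := by
        refine wedge_linearMap_ext fun z w => ?_
        simp only [LinearMap.add_apply, LinearMap.comp_apply, LinearMap.flip_apply,
          wedgeDer_wedge, map_add, triLin_wedge]
        rw [h]
        abel
      exact LinearMap.congr_fun e' Y
    exact LinearMap.congr_fun e X

end MaurerCartan

/-- For p = q = 1 the sign (-1)^{pq} is -1, so [Π, Π] = 2 Π ∘ Π, and 2 is invertible. -/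
theorem isMaurerCartan_iff {K : Type*} [Field K] [CharZero K] {g : Type*} [AddCommGroup g]
    [Module K g] (Φ : Cochain K g 1) :
    IsMaurerCartan (L := fun p => Cochain K g p) (lieYBracket K g) Φ ↔ comp Φ Φ = 0 := by
  rw [IsMaurerCartan, lieYBracket_lof]
  have h : DirectSum.lof K ℕ (fun n => Cochain K g n) (1 + 1) (comp Φ Φ) -
      (-1 : K) ^ (1 * 1) • DirectSum.lof K ℕ (fun n => Cochain K g n) (1 + 1) (comp Φ Φ) =
      DirectSum.lof K ℕ (fun n => Cochain K g n) (1 + 1) ((2 : K) • comp Φ Φ) := by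
    rw [map_smul, two_smul]
    simp
  rw [h]
  constructor
  · intro h
    have h' := DirectSum.of_injective (β := fun n => Cochain K g n) (1 + 1)
      (h.trans (map_zero _).symm)
    exact (smul_eq_zero.1 h').resolve_left two_ne_zero
  · intro h
    rw [h, smul_zero, map_zero]

end LieYamaguti

end

theorem theorem3 (K : Type*) [Field K] [CharZero K] (g : Type*) [AddCommGroup g] [Module K g] :
    LieYamaguti.IsGradedLieBracket K (fun p => LieYamaguti.Cochain K g p)
        (LieYamaguti.lieYBracket K g) ∧
      (∀ Φ : LieYamaguti.Cochain K g 1, LieYamaguti.IsLieYamaguti Φ →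
        LieYamaguti.IsMaurerCartan (L := fun p => LieYamaguti.Cochain K g p)
          (LieYamaguti.lieYBracket K g) Φ) ∧
      (∀ Φ : LieYamaguti.Cochain K g 1,
        LieYamaguti.IsMaurerCartan (L := fun p => LieYamaguti.Cochain K g p)
            (LieYamaguti.lieYBracket K g) Φ ↔
          (∀ x y z w : g,
            Φ.tri x y (Φ.bin z w) = Φ.bin (Φ.tri x y z) w + Φ.bin z (Φ.tri x y w)) ∧
          (∀ x y z w t : g,
            Φ.tri x y (Φ.tri z w t) =
              Φ.tri (Φ.tri x y z) w t + Φ.tri z (Φ.tri x y w) t + Φ.tri z w (Φ.tri x y t))) := by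
  refine ⟨LieYamaguti.isGradedLieBracket_lieYBracket, fun Φ hΦ => ?_, fun Φ => ?_⟩
  · rw [LieYamaguti.isMaurerCartan_iff, LieYamaguti.comp_self_eq_zero_iff]
    exact ⟨hΦ.deriv_bin, hΦ.deriv_tri⟩
  · rw [LieYamaguti.isMaurerCartan_iff, LieYamaguti.comp_self_eq_zero_iff]
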